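/- **Setting.** Let $1\le N\le 3$, let $\Omega\subset\mathbb R^N$ be a bounded open set, and let $\mathbb H=(H_0^1(\Omega))^d$ with its product norm. Let $\lambda_1(\Omega)$ be the first Dirichlet eigenvalue of $-\Delta$ in $\Omega$, and let $|\cdot|_p$ be the norm of $L^p(\Omega)$. Fix integers $0=a_0<a_1<\dots<a_m=d$ and put $I_h=\{i: a_{h-1}<i\le a_h\}$ for $h=1,\dots,m$. Let $\mathcal K_1$ be the set of pairs $(i,j)$ with $i\ne j$ in the same group $I_h$, and $\mathcal K_2$ the set of pairs $(i,j)\in I_h\times I_k$ with $h\neq k$. For $V=(V_i)$ and $B=(\beta_{ij})$ with entries in $L^\infty(\Omega)$ and $\mathbf u\in\mathbb H$ let $\|u_i\|_{V_i}^2=\int_\Omega(|\nabla u_i|^2+V_iu_i^2)$ and $$J_{V,B}(\mathbf u)=\frac12\sum_{i=1}^d\|u_i\|_{V_i}^2-\frac14\sum_{i,j=1}^d\int_\Omega\beta_{ij}u_i^2u_j^2 .$$ For a functional $J$ on $\mathbb H$ let $$\mathcal N(V,J)=\Big\{\mathbf u\in\mathbb H:\ \sum_{i\in I_h}\|u_i\|_{V_i}^2\ne0\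 \text{ and }\ \sum_{i\in I_h}\partial_iJ(\mathbf u)u_i=0\ \text{ for every } h=1,\dots,m\Big\},$$ and $\mathcal N_{V,B}=\mathcal N(V,J_{V,B})$. Call $(V,B)$ admissible if $\beta_{ij}=\beta_{ji}$ for all $i,j$; for every $i$ there is a constant $l_i>-\lambda_1(\Omega)$ with $V_i\ge l_i$ a.e.; for every $i$ there is a constant $\mu_i>0$ with $\beta_{ii}\ge\mu_i$ a.e.; and $\beta_{ij}\ge0$ a.e. for every $(i,j)\in\mathcal K_1$. Let $(V^\infty,B^\infty)$ be admissible, and set $$J_\infty(\mathbf u)=\frac12\sum_{i=1}^d\|u_i\|_{V_i^\infty}^2-\frac14\sum_{h=1}^m\sum_{(i,j)\in I_h^2}\int_\Omega\beta_{ij}^\infty u_i^2u_j^2,\qquad \mathcal N_\infty=\mathcal N(V^\infty,J_\infty).$$ **Theorem.** There are constants $\overline\gamma,\underline\gamma,\bar M>0$, depending only on $\Omega$, the decomposition $(a_h)$ and $(V^\infty,B^\infty)$, with the following property. Let $(V^n,B^n)_{n\in\mathbb N}$ be admissible with $\beta^n_{ij}\le0$ a.e. for every $n$ and every $(i,j)\in\mathcal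 K_2$. Suppose that, in $L^\infty(\Omega)$ as $n\to\infty$, $V_i^n\to V_i^\infty$ and $\beta^n_{ii}\to\beta^\infty_{ii}$ for every $i$, $\beta_{ij}^n\to\beta_{ij}^\infty$ for every $(i,j)\in\mathcal K_1$, and $\beta^n_{ij}\to-\infty$ for every $(i,j)\in\mathcal K_2$ (that is, for every $C\in\mathbb R$ one has $\beta_{ij}^n\le C$ a.e. in $\Omega$ for all large $n$). For every $n$ let $\mathbf u^n$ be a minimizer of $J_{V^n,B^n}$ on $\mathcal N_{V^n,B^n}$. Then: 1. for all large $n$, $$\sum_{i=1}^d\int_\Omega|\nabla u_i^n|^2\le\overline\gamma,\qquad \sum_{i\in I_h}|u_i^n|_4^2\ge\underline\gamma\ \ (h=1,\dots,m),\qquad \sum_{i,j=1}^d\int_\Omega(\beta_{ij}^n)^-(u_i^nu_j^n)^2\le\bar M;$$ 2. a subsequence of $(\mathbf u^n)$ converges strongly in $\mathbb H$ to some $\mathbf u^\infty$ which achieves $$\inf\Big\{J_\infty(\mathbf u):\ \mathbf u\in\mathcal N_\infty\ \text{ and }\ \int_\Omega u_i^2u_j^2=0\ \text{ for every }(i,j)\in\mathcal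 K_2\Big\},$$ and the three estimates in 1. hold, with the same constants and for every $n$, with $\mathbf u^\infty$ in place of $\mathbf u^n$; 3. $\displaystyle\lim_{n\to\infty}\sum_{(i,j)\in\mathcal K_2}\int_\Omega(\beta_{ij}^n)^-(u_i^nu_j^n)^2=0.$ -/

import Mathlib

open MeasureTheory Filter Topology Set
open scoped ContDiff Gradient ENNReal BigOperators

noncomputable section

namespace Segregation

/-- `ℝ^N` with its Euclidean norm. -/
abbrev Eucl (N : ℕ) : Type := EuclideanSpace ℝ (Fin N)

/-! ### Function spaces -/

/-- Lebesgue measure on `Ω`. -/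
abbrev vol {N : ℕ} (Ω : Set (Eucl N)) : Measure (Eucl N) := volume.restrict Ω

/-- The space `L^∞(Ω)` with its norm. -/
abbrev LInf {N : ℕ} (Ω : Set (Eucl N)) : Type := Lp ℝ ∞ (vol Ω)

/-- The Hilbert space `L²(Ω) × L²(Ω; ℝ^N)` of pairs `(u, g)`, with squared norm `∫ u² + ∫ |g|²`. -/
abbrev L2Pair {N : ℕ} (Ω : Set (Eucl N)) : Type :=
  WithLp 2 (Lp ℝ 2 (vol Ω) × Lp (Eucl N) 2 (vol Ω))

/-- The pairs `(φ, ∇φ)`, where `φ` is a smooth function with compact support contained in `Ω`. -/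
def testPairs {N : ℕ} (Ω : Set (Eucl N)) : Submodule ℝ (L2Pair Ω) where
  carrier := {p | ∃ φ : Eucl N → ℝ, ContDiff ℝ ∞ φ ∧ HasCompactSupport φ ∧ tsupport φ ⊆ Ω ∧
    (p.fst : Eucl N → ℝ) =ᵐ[vol Ω] φ ∧ (p.snd : Eucl N → Eucl N) =ᵐ[vol Ω] ∇ φ}
  zero_mem' := by
    refine ⟨fun _ => 0, contDiff_const, HasCompactSupport.zero, ?_, ?_, ?_⟩
    · simp [tsupport]
    · exact Lp.coeFn_zero ℝ 2 (vol Ω)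
    · rw [gradient_fun_const']
      exact Lp.coeFn_zero (Eucl N) 2 (vol Ω)
  add_mem' := by
    rintro p q ⟨φ, hφ, cφ, sφ, p1, p2⟩ ⟨ψ, hψ, cψ, sψ, q1, q2⟩
    refine ⟨φ + ψ, hφ.add hψ, cφ.add cψ, (tsupport_add φ ψ).trans (union_subset sφ sψ), ?_, ?_⟩
    · exact (Lp.coeFn_add p.fst q.fst).trans (p1.add q1)
    · refine (Lp.coeFn_add p.snd q.snd).trans ((p2.add q2).trans (Eventually.of_forall ?_))
      intro x
      simp only [gradient, Pi.add_apply]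
      rw [fderiv_add ((hφ.differentiable (by simp)) x) ((hψ.differentiable (by simp)) x), map_add]
  smul_mem' := by
    rintro c p ⟨φ, hφ, cφ, sφ, p1, p2⟩
    refine ⟨c • φ, hφ.const_smul c, cφ.smul_left (f := fun _ => c),
      (tsupport_smul_subset_right (fun _ => c) φ).trans sφ, ?_, ?_⟩
    · exact (Lp.coeFn_smul c p.fst).trans (p1.const_smul c)
    · refine (Lp.coeFn_smul c p.snd).trans ((p2.const_smul c).trans (Eventually.of_forall ?_))
      intro x
      simp only [gradient, Pi.smul_apply]
      rw [fderiv_const_smul ((hφ.differentiable (by simp)) x)]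
      simp

/-- The Sobolev space `H₀¹(Ω)`: the closure of `C_c^∞(Ω)` in the `H¹` norm. A function `u` is
stored together with its (weak) gradient, as the pair `(u, ∇u)` in `L²(Ω) × L²(Ω; ℝ^N)`. -/
abbrev H01 {N : ℕ} (Ω : Set (Eucl N)) : Submodule ℝ (L2Pair Ω) :=
  (testPairs Ω).topologicalClosure

/-- The function underlying an element of `H₀¹(Ω)`. -/
def val {N : ℕ} {Ω : Set (Eucl N)} (u : H01 Ω) : Eucl N → ℝ := (u : L2Pair Ω).fst

/-- The weak gradient of an element of `H₀¹(Ω)`. -/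
def grad {N : ℕ} {Ω : Set (Eucl N)} (u : H01 Ω) : Eucl N → Eucl N := (u : L2Pair Ω).snd

/-- The Hilbert space `ℍ = H₀¹(Ω)^d` with its product norm. -/
abbrev HProd {N : ℕ} (Ω : Set (Eucl N)) (d : ℕ) : Type := PiLp 2 (fun _ : Fin d => H01 Ω)

/-- The first Dirichlet eigenvalue `λ₁(Ω)` of `-Δ`, as the infimum of the Rayleigh quotient. -/
def firstEigenvalue {N : ℕ} (Ω : Set (Eucl N)) : ℝ :=
  sInf {r : ℝ | ∃ u : H01 Ω, u ≠ 0 ∧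
    r = (∫ x, ‖grad u x‖ ^ 2 ∂(vol Ω)) / (∫ x, val u x ^ 2 ∂(vol Ω))}

/-! ### Decompositions into groups -/

/-- `0 = a_0 < a_1 < ⋯ < a_m = d`. -/
def IsDecomposition (m d : ℕ) (a : Fin (m + 1) → ℕ) : Prop :=
  a 0 = 0 ∧ StrictMono a ∧ a (Fin.last m) = d

/-- The groups of indices. Group number `h` (counted from `0`) consists of the indices `i`
(counted from `0`) with `a_h ≤ i < a_{h+1}`. -/
def group {m : ℕ} (d : ℕ) (a : Fin (m + 1) → ℕ) (h : Fin m) : Finset (Fin d) :=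
  Finset.univ.filter fun i => a h.castSucc ≤ (i : ℕ) ∧ (i : ℕ) < a h.succ

/-- Pairs of distinct indices of the same group. -/
def K1 {m : ℕ} (d : ℕ) (a : Fin (m + 1) → ℕ) : Set (Fin d × Fin d) :=
  {p | p.1 ≠ p.2 ∧ ∃ h, p.1 ∈ group d a h ∧ p.2 ∈ group d a h}

/-- Pairs of indices of different groups. -/
def K2 {m : ℕ} (d : ℕ) (a : Fin (m + 1) → ℕ) : Set (Fin d × Fin d) :=
  {p | ∃ h k, h ≠ k ∧ p.1 ∈ group d a h ∧ p.2 ∈ group d a k}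

/-! ### Energies and Nehari-type sets -/

section Energy

variable {N : ℕ} {Ω : Set (Eucl N)} {d m : ℕ}

/-- `‖u‖_V² = ∫ (|∇u|² + V u²)`. -/
def normSq (V : LInf Ω) (u : H01 Ω) : ℝ :=
  ∫ x, (‖grad u x‖ ^ 2 + V x * val u x ^ 2) ∂(vol Ω)

/-- `∫ β u² v²`. -/
def coupling (β : LInf Ω) (u v : H01 Ω) : ℝ :=
  ∫ x, β x * val u x ^ 2 * val v x ^ 2 ∂(vol Ω)

/-- The energy functional `J_{V,B}`. -/
def energy (V : Fin d → LInf Ω) (B : Fin d → Fin d → LInf Ω) (u : HProd Ω d) : ℝ :=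
  (1 / 2) * ∑ i, normSq (V i) (u i) - (1 / 4) * ∑ i, ∑ j, coupling (B i j) (u i) (u j)

/-- The limit functional `J_∞`, in which different groups do not interact. -/
def limitEnergy (a : Fin (m + 1) → ℕ) (V : Fin d → LInf Ω) (B : Fin d → Fin d → LInf Ω)
    (u : HProd Ω d) : ℝ :=
  (1 / 2) * ∑ i, normSq (V i) (u i) -
    (1 / 4) * ∑ h, ∑ i ∈ group d a h, ∑ j ∈ group d a h, coupling (B i j) (u i) (u j)

/-- The partial derivative `∂_i J(u) v`: the derivative at `u` of `J` in the direction of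
`(0, …, 0, v, 0, …, 0)` with `v` in position `i`. -/
def partialDeriv (J : HProd Ω d → ℝ) (u : HProd Ω d) (i : Fin d) (v : H01 Ω) : ℝ :=
  lineDeriv ℝ J u (PiLp.single 2 i v)

/-- The Nehari-type set of a functional `J`: those `u` with `∑_{i ∈ I_h} ‖u_i‖_{V_i}² ≠ 0` and
`∑_{i ∈ I_h} ∂_i J(u) u_i = 0` for every group `I_h`. -/
def nehari (a : Fin (m + 1) → ℕ) (V : Fin d → LInf Ω) (J : HProd Ω d → ℝ) :
    Set (HProd Ω d) :=
  {u | ∀ h : Fin m, (∑ i ∈ group d a h, normSq (V i) (u i)) ≠ 0 ∧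
    ∑ i ∈ group d a h, partialDeriv J u i (u i) = 0}

/-- The standing assumptions on potentials and couplings: `B` is symmetric,
`V_i ≥ l_i > -λ₁(Ω)`, `β_ii ≥ μ_i > 0`, and `β_ij ≥ 0` inside each group. -/
def Admissible (a : Fin (m + 1) → ℕ) (V : Fin d → LInf Ω) (B : Fin d → Fin d → LInf Ω) : Prop :=
  (∀ i j, B i j = B j i) ∧
  (∀ i, ∃ l : ℝ, -firstEigenvalue Ω < l ∧ ∀ᵐ x ∂(vol Ω), l ≤ V i x) ∧
  (∀ i, ∃ μ : ℝ, 0 < μ ∧ ∀ᵐ x ∂(vol Ω), μ ≤ B i i x) ∧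
  (∀ i j, (i, j) ∈ K1 d a → ∀ᵐ x ∂(vol Ω), 0 ≤ B i j x)

/-- `∫ β⁻ (u v)²`, with `β⁻ = max(-β, 0)`. -/
def negCoupling (β : LInf Ω) (u v : H01 Ω) : ℝ :=
  ∫ x, max (-β x) 0 * (val u x * val v x) ^ 2 ∂(vol Ω)

/-- The energy of the competitive interaction between different groups. -/
def interGroup (a : Fin (m + 1) → ℕ) (B : Fin d → Fin d → LInf Ω) (u : HProd Ω d) : ℝ :=
  open Classical in
  ∑ p ∈ Finset.univ.filter (fun p : Fin d × Fin d => p ∈ K2 d a),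
    negCoupling (B p.1 p.2) (u p.1) (u p.2)

/-- The bounds `∑_i ∫ |∇u_i|² ≤ γU`, `∑_{i ∈ I_h} |u_i|_4² ≥ γL` for every group `I_h`, and
`∑_{i,j} ∫ β_ij⁻ (u_i u_j)² ≤ M`. -/
def Estimates (a : Fin (m + 1) → ℕ) (B : Fin d → Fin d → LInf Ω) (γU γL M : ℝ)
    (u : HProd Ω d) : Prop :=
  (∑ i, ∫ x, ‖grad (u i) x‖ ^ 2 ∂(vol Ω) ≤ γU) ∧
  (∀ h : Fin m, γL ≤ ∑ i ∈ group d a h, (eLpNorm (val (u i)) 4 (vol Ω)).toReal ^ 2) ∧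
  (∑ i, ∑ j, negCoupling (B i j) (u i) (u j) ≤ M)

/-- The admissible set of the limit problem: the Nehari-type set of `J_∞`, under the constraint
that components of different groups satisfy `∫ u_i² u_j² = 0`. -/
def limitSet (a : Fin (m + 1) → ℕ) (V : Fin d → LInf Ω) (B : Fin d → Fin d → LInf Ω) :
    Set (HProd Ω d) :=
  {u | u ∈ nehari a V (limitEnergy a V B) ∧
    ∀ i j, (i, j) ∈ K2 d a → ∫ x, val (u i) x ^ 2 * val (u j) x ^ 2 ∂(vol Ω) = 0}

end Energy

end Segregation

/-!
A segregated function whose groups `h` have quadratic part `q_h > 0` and self-interaction `D_h > 0`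
can be rescaled group by group onto the Nehari-type set, where its energy is `¼ ∑ q_h² / D_h`
whatever the repulsion between the groups. Comparison with a fixed segregated competitor bounds the
energies of the minimizers uniformly, and with them the three quantities of the estimates.

Along an ultrafilter the minimizers converge weakly in `H₀¹`, hence strongly in `L²` and `L⁴`. The
energy of the repulsion stays bounded while its strength tends to infinity, so the limit is
segregated. Let `e_h ≥ 0` be the squared norm that the group `h` loses in the weak limit. Since
repulsion has a sign, the Nehari constraint of the minimizers gives `q_h ≤ q_h + e_h ≤ D_h` in the
limit, and comparing the minimizers with the rescaled limit gives
`∑ (q_h + e_h) ≤ ∑ q_h² / D_h ≤ ∑ q_h`. So all these inequalities are equalities: `e_h = 0` is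
strong convergence, `q_h = D_h` puts the limit in the Nehari-type set, and the interaction between
the groups, which tends to `∑ D_h - ∑ (q_h + e_h)`, vanishes.
-/

noncomputable section

namespace Segregation

/-! ### The Sobolev inequality -/

section Sobolev

variable {N : ℕ} {Ω : Set (Eucl N)}

lemma eLpNorm_gradient_eq (φ : Eucl N → ℝ) (p : ℝ≥0∞) (μ : Measure (Eucl N)) :
    eLpNorm (∇ φ) p μ = eLpNorm (fderiv ℝ φ) p μ :=
  eLpNorm_congr_norm_ae (.of_forall fun x => by simp only [gradient, LinearIsometryEquiv.norm_map])

lemma aestronglyMeasurable_val (u : H01 Ω) : AEStronglyMeasurable (val u) (vol Ω) :=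
  Lp.aestronglyMeasurable _

lemma memLp_val (u : H01 Ω) : MemLp (val u) 2 (vol Ω) := Lp.memLp _

lemma memLp_grad (u : H01 Ω) : MemLp (grad u) 2 (vol Ω) := Lp.memLp _

lemma isFiniteMeasure_vol (hΩb : Bornology.IsBounded Ω) : IsFiniteMeasure (vol Ω) :=
  ⟨by simpa only [Measure.restrict_apply_univ] using hΩb.measure_lt_top⟩

lemma eLpNorm_vol_eq_of_support_subset {F : Type*} [NormedAddCommGroup F] {f : Eucl N → F}
    (p : ℝ≥0∞) (hf : Function.support f ⊆ Ω) : eLpNorm f p (vol Ω) = eLpNorm f p volume :=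
  eLpNorm_restrict_eq_of_support_subset hf

lemma enorm_le_lintegral_fderiv {φ : Eucl 1 → ℝ} (hφ : ContDiff ℝ 1 φ) (hc : HasCompactSupport φ)
    (x : Eucl 1) : ‖φ x‖ₑ ≤ ∫⁻ y, ‖fderiv ℝ φ y‖ₑ := by
  let L : ℝ ≃ₗᵢ[ℝ] Eucl 1 := (OrthonormalBasis.singleton (Fin 1) ℝ).repr
  have hderiv : ∀ t, ‖deriv (φ ∘ L) t‖ₑ ≤ ‖fderiv ℝ φ (L t)‖ₑ := by
    intro t
    have hL : HasDerivAt L (L 1) t := L.toContinuousLinearEquiv.toContinuousLinearMap.hasDerivAt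
    rw [((hφ.differentiable one_ne_zero (L t)).hasFDerivAt.comp_hasDerivAt t hL).deriv]
    refine enorm_le_iff_norm_le.2 (((fderiv ℝ φ (L t)).le_opNorm (L 1)).trans_eq ?_)
    rw [L.norm_map, norm_one, mul_one]
  calc ‖φ x‖ₑ = ‖(φ ∘ L) (L.symm x)‖ₑ := by
        rw [Function.comp_apply, L.apply_symm_apply]
    _ ≤ ∫⁻ t in Iic (L.symm x), ‖deriv (φ ∘ L) t‖ₑ :=
        (hc.comp_homeomorph L.toHomeomorph).enorm_le_lintegral_Ici_deriv
          (hφ.comp L.toContinuousLinearEquiv.contDiff) (L.symm x)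
    _ ≤ ∫⁻ t, ‖deriv (φ ∘ L) t‖ₑ := setLIntegral_le_lintegral _ _
    _ ≤ ∫⁻ t, ‖fderiv ℝ φ (L t)‖ₑ := lintegral_mono hderiv
    _ = ∫⁻ y, ‖fderiv ℝ φ y‖ₑ :=
      L.measurePreserving.lintegral_comp_emb L.toHomeomorph.measurableEmbedding
        (fun y => ‖fderiv ℝ φ y‖ₑ)

lemma eLpNorm_le_mul_eLpNorm_one_fderiv {Ω : Set (Eucl 1)} {φ : Eucl 1 → ℝ} (p : ℝ≥0∞)
    (hφ : ContDiff ℝ 1 φ) (hc : HasCompactSupport φ) :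
    eLpNorm φ p (vol Ω) ≤ vol Ω univ ^ (1 / p.toReal) * eLpNorm (fderiv ℝ φ) 1 volume := by
  have htop : eLpNorm φ ⊤ (vol Ω) ≤ eLpNorm (fderiv ℝ φ) 1 volume := by
    rw [eLpNorm_exponent_top, eLpNorm_one_eq_lintegral_enorm]
    exact essSup_le_of_ae_le _ (.of_forall (enorm_le_lintegral_fderiv hφ hc))
  refine (eLpNorm_le_eLpNorm_mul_rpow_measure_univ le_top
    hφ.continuous.aestronglyMeasurable).trans ?_
  rw [mul_comm, ENNReal.toReal_top, div_zero, sub_zero]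
  gcongr

lemma exists_eLpNorm_le_eLpNorm_fderiv {p q : NNReal} (hp : 1 ≤ p) (hpN : p < N)
    (hpq : (p : ℝ)⁻¹ - (N : ℝ)⁻¹ ≤ (q : ℝ)⁻¹) (hΩb : Bornology.IsBounded Ω) :
    ∃ C : ℝ≥0∞, C ≠ ⊤ ∧ ∀ φ : Eucl N → ℝ, ContDiff ℝ 1 φ → Function.support φ ⊆ Ω →
      eLpNorm φ q (vol Ω) ≤ C * eLpNorm (fderiv ℝ φ) p volume := by
  refine ⟨_, ENNReal.coe_ne_top, fun φ hφ hs =>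
    (eLpNorm_mono_measure φ Measure.restrict_le_self).trans
      (eLpNorm_le_eLpNorm_fderiv_of_le (F := ℝ) (μ := volume) hφ hs hp ?_ ?_ hΩb)⟩
  · rwa [finrank_euclideanSpace_fin]
  · rwa [finrank_euclideanSpace_fin, NNReal.coe_inv]

lemma exists_eLpNorm_six_le_eLpNorm_fderiv (hN : 1 ≤ N) (hN3 : N ≤ 3)
    (hΩb : Bornology.IsBounded Ω) :
    ∃ (C p : ℝ≥0∞), C ≠ ⊤ ∧ 1 ≤ p ∧ p ≤ 2 ∧ ∀ φ : Eucl N → ℝ, ContDiff ℝ 1 φ →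
      HasCompactSupport φ → Function.support φ ⊆ Ω →
        eLpNorm φ 6 (vol Ω) ≤ C * eLpNorm (fderiv ℝ φ) p volume := by
  have := isFiniteMeasure_vol hΩb
  obtain rfl | rfl | rfl : N = 1 ∨ N = 2 ∨ N = 3 := by omega
  · exact ⟨_, 1, (ENNReal.rpow_lt_top_of_nonneg (by positivity) (measure_ne_top _ _)).ne, le_rfl,
      one_le_two, fun φ hφ hc _ => eLpNorm_le_mul_eLpNorm_one_fderiv 6 hφ hc⟩
  · have hp : (1 : NNReal) ≤ 3 / 2 ∧ (3 / 2 : NNReal) < 2 := by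
      simp only [← NNReal.coe_le_coe, ← NNReal.coe_lt_coe]; norm_num
    obtain ⟨C, hC, h⟩ := exists_eLpNorm_le_eLpNorm_fderiv (p := 3 / 2) (q := 6) hp.1
      (mod_cast hp.2) (by norm_num) hΩb
    exact ⟨C, _, hC, mod_cast hp.1, mod_cast hp.2.le, fun φ hφ _ hs => h φ hφ hs⟩
  · obtain ⟨C, hC, h⟩ := exists_eLpNorm_le_eLpNorm_fderiv (p := 2) (q := 6) one_le_two
      (by norm_num) (by norm_num) hΩb
    exact ⟨C, 2, hC, one_le_two, le_rfl, fun φ hφ _ hs => h φ hφ hs⟩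

lemma exists_eLpNorm_six_le_eLpNorm_gradient (hN : 1 ≤ N) (hN3 : N ≤ 3)
    (hΩb : Bornology.IsBounded Ω) :
    ∃ C : ℝ≥0∞, C ≠ ⊤ ∧ ∀ φ : Eucl N → ℝ, ContDiff ℝ 1 φ → HasCompactSupport φ →
      tsupport φ ⊆ Ω → eLpNorm φ 6 (vol Ω) ≤ C * eLpNorm (∇ φ) 2 (vol Ω) := by
  obtain ⟨C, p, hC, hp1, hp2, h⟩ := exists_eLpNorm_six_le_eLpNorm_fderiv hN hN3 hΩb
  have := isFiniteMeasure_vol hΩb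
  have hp : 0 ≤ 1 / p.toReal - 1 / (2 : ℝ≥0∞).toReal := by
    refine sub_nonneg.2 (one_div_le_one_div_of_le (ENNReal.toReal_pos (by positivity) ?_) ?_)
    · exact ne_top_of_le_ne_top ENNReal.ofNat_ne_top hp2
    · exact ENNReal.toReal_mono ENNReal.ofNat_ne_top hp2
  refine ⟨C * vol Ω univ ^ (1 / p.toReal - 1 / (2 : ℝ≥0∞).toReal), ?_, fun φ hφ hc hs => ?_⟩
  · exact ENNReal.mul_ne_top hC (ENNReal.rpow_lt_top_of_nonneg hp (measure_ne_top _ _)).ne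
  · have hsupp : eLpNorm (fderiv ℝ φ) p (vol Ω) = eLpNorm (fderiv ℝ φ) p volume :=
      eLpNorm_vol_eq_of_support_subset p ((support_fderiv_subset ℝ).trans hs)
    have holder := eLpNorm_le_eLpNorm_mul_rpow_measure_univ (μ := vol Ω) hp2
      (hφ.continuous_fderiv one_ne_zero).aestronglyMeasurable
    rw [eLpNorm_gradient_eq, mul_assoc, mul_comm (_ ^ _)]
    exact (h φ hφ hc ((subset_tsupport φ).trans hs)).trans
      (mul_le_mul_right (hsupp.symm.trans_le holder) C)

theorem exists_eLpNorm_six_val_le (hN : 1 ≤ N) (hN3 : N ≤ 3) (hΩb : Bornology.IsBounded Ω) :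
    ∃ C : ℝ≥0∞, C ≠ ⊤ ∧ ∀ u : H01 Ω,
      eLpNorm (val u) 6 (vol Ω) ≤ C * eLpNorm (grad u) 2 (vol Ω) := by
  obtain ⟨C, hC, h⟩ := exists_eLpNorm_six_le_eLpNorm_gradient hN hN3 hΩb
  refine ⟨C, hC, fun u => ?_⟩
  obtain ⟨p, hp, hlim⟩ := mem_closure_iff_seq_limit.1
    (show (u : L2Pair Ω) ∈ closure (testPairs Ω : Set (L2Pair Ω)) from u.2)
  have hfst : Tendsto (fun n => (p n).fst) atTop (𝓝 (u : L2Pair Ω).fst) :=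
    ((WithLp.prod_continuous_ofLp 2 _ _).fst.tendsto _).comp hlim
  have hsnd : Tendsto (fun n => (p n).snd) atTop (𝓝 (u : L2Pair Ω).snd) :=
    ((WithLp.prod_continuous_ofLp 2 _ _).snd.tendsto _).comp hlim
  obtain ⟨ns, hns, hae⟩ := (tendstoInMeasure_of_tendsto_Lp hfst).exists_seq_tendsto_ae
  have hgrad : Tendsto (fun n => C * eLpNorm (p (ns n)).snd 2 (vol Ω)) atTop
      (𝓝 (C * eLpNorm (grad u) 2 (vol Ω))) := by
    refine ENNReal.Tendsto.const_mul ?_ (.inr hC)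
    simpa only [Function.comp_def, Lp.enorm_def, grad] using (hsnd.comp hns.tendsto_atTop).enorm
  calc eLpNorm (val u) 6 (vol Ω)
      ≤ liminf (fun n => eLpNorm (p (ns n)).fst 6 (vol Ω)) atTop :=
        Lp.eLpNorm_lim_le_liminf_eLpNorm (fun n => Lp.aestronglyMeasurable _) _ hae
    _ ≤ liminf (fun n => C * eLpNorm (p (ns n)).snd 2 (vol Ω)) atTop := by
        refine liminf_le_liminf (.of_forall fun n => ?_)
        obtain ⟨φ, hφ, hc, hs, hfst, hsnd⟩ := hp (ns n)
        rw [eLpNorm_congr_ae hfst, eLpNorm_congr_ae hsnd]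
        exact h φ (hφ.of_le (by simp)) hc hs
    _ = C * eLpNorm (grad u) 2 (vol Ω) := hgrad.liminf_eq

end Sobolev

/-! ### The Rellich theorem -/

section Variance

variable {α : Type*} [MeasurableSpace α] {μ : Measure α} {f : α → ℝ}

lemma sq_lintegral_le_lintegral_sq [IsProbabilityMeasure μ] {f : α → ℝ≥0∞}
    (hf : AEMeasurable f μ) : (∫⁻ x, f x ∂μ) ^ 2 ≤ ∫⁻ x, f x ^ 2 ∂μ := by
  have holder := ENNReal.lintegral_mul_le_Lp_mul_Lq μ Real.HolderConjugate.two_two hf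
    (aemeasurable_const (b := (1 : ℝ≥0∞)))
  simp only [Pi.mul_apply, mul_one, ENNReal.rpow_ofNat, one_pow, lintegral_const, measure_univ,
    ENNReal.one_rpow] at holder
  calc (∫⁻ x, f x ∂μ) ^ 2 ≤ ((∫⁻ x, f x ^ 2 ∂μ) ^ (1 / (2 : ℝ))) ^ 2 := by gcongr
    _ = ∫⁻ x, f x ^ 2 ∂μ := by
      rw [← ENNReal.rpow_natCast, ← ENNReal.rpow_mul]; norm_num

variable [IsFiniteMeasure μ]

lemma integrable_quadratic (hf : Integrable f μ) (hf2 : Integrable (fun x => f x ^ 2) μ)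
    (a b c : ℝ) : Integrable (fun x => a * f x ^ 2 + b * f x + c) μ :=
  ((hf2.const_mul a).add (hf.const_mul b)).add (integrable_const c)

lemma integral_quadratic (hf : Integrable f μ) (hf2 : Integrable (fun x => f x ^ 2) μ)
    (a b c : ℝ) : ∫ x, (a * f x ^ 2 + b * f x + c) ∂μ =
      a * (∫ x, f x ^ 2 ∂μ) + b * (∫ x, f x ∂μ) + μ.real univ * c := by
  rw [integral_add (f := fun x => a * f x ^ 2 + b * f x)
    ((hf2.const_mul a).add (hf.const_mul b)) (integrable_const c),
    integral_add (hf2.const_mul a) (hf.const_mul b), integral_const_mul, integral_const_mul,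
    integral_const, smul_eq_mul]

lemma lintegral_lintegral_enorm_sub_sq (hf : Integrable f μ)
    (hf2 : Integrable (fun x => f x ^ 2) μ) :
    ∫⁻ x, ∫⁻ y, ‖f y - f x‖ₑ ^ 2 ∂μ ∂μ =
      ENNReal.ofReal (2 * (μ.real univ * ∫ x, f x ^ 2 ∂μ - (∫ x, f x ∂μ) ^ 2)) := by
  have expand : ∀ x y, (f y - f x) ^ 2 = 1 * f y ^ 2 + (-2 * f x) * f y + f x ^ 2 :=
    fun x y => by ring
  have inner_eq : ∀ x, ∫ y, (f y - f x) ^ 2 ∂μ =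
      μ.real univ * f x ^ 2 + (-2 * ∫ y, f y ∂μ) * f x + ∫ y, f y ^ 2 ∂μ := fun x => by
    simp_rw [expand, integral_quadratic hf hf2]
    ring
  have inner_lintegral_eq : ∀ x, ∫⁻ y, ‖f y - f x‖ₑ ^ 2 ∂μ =
      ENNReal.ofReal (∫ y, (f y - f x) ^ 2 ∂μ) := fun x => by
    rw [ofReal_integral_eq_lintegral_ofReal _ (.of_forall fun y => sq_nonneg _)]
    · congr 1 with y
      rw [← ofReal_norm, ← ENNReal.ofReal_pow (norm_nonneg _), Real.norm_eq_abs, sq_abs]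
    · simp_rw [expand]
      exact integrable_quadratic hf hf2 _ _ _
  simp_rw [inner_lintegral_eq]
  rw [← ofReal_integral_eq_lintegral_ofReal _
    (.of_forall fun x => integral_nonneg fun y => sq_nonneg _)]
  · simp_rw [inner_eq, integral_quadratic hf hf2]
    ring_nf
  · simp_rw [inner_eq]
    exact integrable_quadratic hf hf2 _ _ _

end Variance

lemma integrable_sq_of_hasCompactSupport {X : Type*} [TopologicalSpace X] [MeasurableSpace X]
    [OpensMeasurableSpace X] {μ : Measure X} [IsFiniteMeasureOnCompacts μ] {f : X → ℝ}
    (hf : Continuous f) (hc : HasCompactSupport f) : Integrable (fun x => f x ^ 2) μ := by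
  have hcont : Continuous fun x => f x ^ 2 := hf.pow 2
  have hsupp : HasCompactSupport fun x => f x ^ 2 :=
    hc.comp_left (g := fun t : ℝ => t ^ 2) (zero_pow two_ne_zero)
  exact hcont.integrable_of_hasCompactSupport hsupp

section Translation

variable {E : Type*} [NormedAddCommGroup E] [NormedSpace ℝ E] {φ : E → ℝ}

lemma enorm_sub_sq_le (hφ : ContDiff ℝ 1 φ) (x h : E) :
    ‖φ (x + h) - φ x‖ₑ ^ 2 ≤
      ‖h‖ₑ ^ 2 * ∫⁻ t in Ioc (0 : ℝ) 1, ‖fderiv ℝ φ (x + t • h)‖ₑ ^ 2 := by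
  have hcont : Continuous fun t : ℝ => fderiv ℝ φ (x + t • h) :=
    (hφ.continuous_fderiv one_ne_zero).comp (by fun_prop)
  have hderiv : ∀ t ∈ uIcc (0 : ℝ) 1,
      HasDerivAt (fun t : ℝ => φ (x + t • h)) (fderiv ℝ φ (x + t • h) h) t := by
    intro t _
    have hline : HasDerivAt (fun t : ℝ => x + t • h) h t := by
      simpa only [id, one_smul] using ((hasDerivAt_id t).smul_const h).const_add x
    exact (hφ.differentiable one_ne_zero _).hasFDerivAt.comp_hasDerivAt t hline
  have ftc : ∫ t in Ioc (0 : ℝ) 1, fderiv ℝ φ (x + t • h) h = φ (x + h) - φ x := by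
    rw [← intervalIntegral.integral_of_le zero_le_one,
      intervalIntegral.integral_eq_sub_of_hasDerivAt hderiv
        ((hcont.clm_apply continuous_const).intervalIntegrable _ _), one_smul, zero_smul, add_zero]
  have : IsProbabilityMeasure (volume.restrict (Ioc (0 : ℝ) 1)) := ⟨by simp⟩
  have hmeas : AEMeasurable (fun t : ℝ => ‖fderiv ℝ φ (x + t • h)‖ₑ)
      (volume.restrict (Ioc (0 : ℝ) 1)) := hcont.enorm.measurable.aemeasurable
  rw [← ftc]
  calc _ ≤ (∫⁻ t in Ioc (0 : ℝ) 1, ‖h‖ₑ * ‖fderiv ℝ φ (x + t • h)‖ₑ) ^ 2 := by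
        gcongr
        refine (enorm_integral_le_lintegral_enorm _).trans (lintegral_mono fun t => ?_)
        rw [mul_comm]
        exact ContinuousLinearMap.le_opENorm _ _
    _ = ‖h‖ₑ ^ 2 * (∫⁻ t in Ioc (0 : ℝ) 1, ‖fderiv ℝ φ (x + t • h)‖ₑ) ^ 2 := by
        rw [lintegral_const_mul'' _ hmeas, mul_pow]
    _ ≤ _ := by gcongr; exact sq_lintegral_le_lintegral_sq hmeas

variable [MeasurableSpace E] [BorelSpace E] [FiniteDimensional ℝ E] {μ : Measure E}
  [μ.IsAddHaarMeasure]

lemma lintegral_enorm_sub_sq_le (hφ : ContDiff ℝ 1 φ) (h : E) :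
    ∫⁻ x, ‖φ (x + h) - φ x‖ₑ ^ 2 ∂μ ≤ ‖h‖ₑ ^ 2 * ∫⁻ x, ‖fderiv ℝ φ x‖ₑ ^ 2 ∂μ := by
  have hcont : Continuous fun p : E × ℝ => ‖fderiv ℝ φ (p.1 + p.2 • h)‖ₑ ^ 2 :=
    (ENNReal.continuous_pow 2).comp
      ((hφ.continuous_fderiv one_ne_zero).comp (by fun_prop)).enorm
  have htranslate : ∀ t : ℝ,
      ∫⁻ x, ‖fderiv ℝ φ (x + t • h)‖ₑ ^ 2 ∂μ = ∫⁻ x, ‖fderiv ℝ φ x‖ₑ ^ 2 ∂μ :=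
    fun t => lintegral_add_right_eq_self (fun x => ‖fderiv ℝ φ x‖ₑ ^ 2) (t • h)
  calc _ ≤ ∫⁻ x, ‖h‖ₑ ^ 2 * (∫⁻ t in Ioc (0 : ℝ) 1, ‖fderiv ℝ φ (x + t • h)‖ₑ ^ 2) ∂μ :=
        lintegral_mono fun x => enorm_sub_sq_le hφ x h
    _ = ‖h‖ₑ ^ 2 * ∫⁻ t in Ioc (0 : ℝ) 1, ∫⁻ x, ‖fderiv ℝ φ (x + t • h)‖ₑ ^ 2 ∂μ := by
        rw [lintegral_const_mul' _ _ (by finiteness), lintegral_lintegral_swap]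
        exact hcont.measurable.aemeasurable
    _ = _ := by simp [htranslate]

lemma lintegral_ball_enorm_sub_sq_le (hφ : ContDiff ℝ 1 φ) {R : ℝ} :
    ∫⁻ x, ∫⁻ y in Metric.ball x R, ‖φ y - φ x‖ₑ ^ 2 ∂μ ∂μ ≤
      μ (Metric.ball 0 R) * ENNReal.ofReal R ^ 2 * ∫⁻ x, ‖fderiv ℝ φ x‖ₑ ^ 2 ∂μ := by
  have htranslate : ∀ x, ∫⁻ y in Metric.ball x R, ‖φ y - φ x‖ₑ ^ 2 ∂μ =
      ∫⁻ h in Metric.ball 0 R, ‖φ (x + h) - φ x‖ₑ ^ 2 ∂μ := by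
    intro x
    rw [← lintegral_indicator measurableSet_ball, ← lintegral_indicator measurableSet_ball,
      ← lintegral_add_left_eq_self _ x]
    congr 1 with h
    simp only [indicator, Metric.mem_ball, dist_self_add_left, dist_zero_right]
  have hcont : Continuous fun p : E × E => ‖φ (p.1 + p.2) - φ p.1‖ₑ ^ 2 := by
    have := hφ.continuous
    exact (ENNReal.continuous_pow 2).comp (Continuous.enorm (by fun_prop))
  simp_rw [htranslate]
  rw [lintegral_lintegral_swap hcont.measurable.aemeasurable]
  calc _ ≤ ∫⁻ h in Metric.ball 0 R, ENNReal.ofReal R ^ 2 * (∫⁻ x, ‖fderiv ℝ φ x‖ₑ ^ 2 ∂μ) ∂μ := by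
        refine setLIntegral_mono measurable_const fun h hh => ?_
        refine (lintegral_enorm_sub_sq_le hφ h).trans ?_
        gcongr
        rw [← ofReal_norm]
        exact ENNReal.ofReal_le_ofReal (mem_ball_zero_iff.1 hh).le
    _ = _ := by rw [setLIntegral_const, mul_comm, mul_assoc]

lemma sum_lintegral_enorm_sub_sq_le (hφ : ContDiff ℝ 1 φ) {ι : Type*} {s : Finset ι}
    {A : ι → Set E} (hA : ∀ k ∈ s, MeasurableSet (A k)) (hd : (s : Set ι).PairwiseDisjoint A)
    {R : ℝ} (hR : ∀ k ∈ s, ∀ x ∈ A k, A k ⊆ Metric.ball x R) :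
    ∑ k ∈ s, ∫⁻ x in A k, ∫⁻ y in A k, ‖φ y - φ x‖ₑ ^ 2 ∂μ ∂μ ≤
      μ (Metric.ball 0 R) * ENNReal.ofReal R ^ 2 * ∫⁻ x, ‖fderiv ℝ φ x‖ₑ ^ 2 ∂μ :=
  calc _ ≤ ∑ k ∈ s, ∫⁻ x in A k, ∫⁻ y in Metric.ball x R, ‖φ y - φ x‖ₑ ^ 2 ∂μ ∂μ :=
        Finset.sum_le_sum fun k hk => setLIntegral_mono' (hA k hk) fun x hx =>
          lintegral_mono_set (hR k hk x hx)
    _ = ∫⁻ x in ⋃ k ∈ s, A k, ∫⁻ y in Metric.ball x R, ‖φ y - φ x‖ₑ ^ 2 ∂μ ∂μ :=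
        (lintegral_biUnion_finset hd hA _).symm
    _ ≤ ∫⁻ x, ∫⁻ y in Metric.ball x R, ‖φ y - φ x‖ₑ ^ 2 ∂μ ∂μ := setLIntegral_le_lintegral _ _
    _ ≤ _ := lintegral_ball_enorm_sub_sq_le hφ

lemma sum_measureReal_mul_integral_sq_sub_le (hφ : ContDiff ℝ 1 φ) (hc : HasCompactSupport φ)
    {ι : Type*} {s : Finset ι} {A : ι → Set E} (hA : ∀ k ∈ s, MeasurableSet (A k))
    (hd : (s : Set ι).PairwiseDisjoint A) {R : ℝ} (hR0 : 0 ≤ R)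
    (hR : ∀ k ∈ s, ∀ x ∈ A k, A k ⊆ Metric.ball x R) :
    ∑ k ∈ s, 2 * (μ.real (A k) * (∫ x in A k, φ x ^ 2 ∂μ) - (∫ x in A k, φ x ∂μ) ^ 2) ≤
      μ.real (Metric.ball 0 R) * R ^ 2 * ∫ x, ‖fderiv ℝ φ x‖ ^ 2 ∂μ := by
  have hvar : ∀ k ∈ s, ENNReal.ofReal
      (2 * (μ.real (A k) * (∫ x in A k, φ x ^ 2 ∂μ) - (∫ x in A k, φ x ∂μ) ^ 2)) =
      ∫⁻ x in A k, ∫⁻ y in A k, ‖φ y - φ x‖ₑ ^ 2 ∂μ ∂μ := by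
    intro k hk
    have : IsFiniteMeasure (μ.restrict (A k)) := by
      refine ⟨?_⟩
      rw [Measure.restrict_apply_univ]
      obtain hk0 | ⟨x, hx⟩ := (A k).eq_empty_or_nonempty
      · rw [hk0, measure_empty]
        exact ENNReal.zero_lt_top
      · exact (measure_mono (hR k hk x hx)).trans_lt measure_ball_lt_top
    rw [lintegral_lintegral_enorm_sub_sq
      (hφ.continuous.integrable_of_hasCompactSupport hc).restrict
      (integrable_sq_of_hasCompactSupport hφ.continuous hc).restrict,
      measureReal_restrict_apply_univ]
  have hgrad : ENNReal.ofReal (μ.real (Metric.ball 0 R) * R ^ 2 * ∫ x, ‖fderiv ℝ φ x‖ ^ 2 ∂μ) =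
      μ (Metric.ball 0 R) * ENNReal.ofReal R ^ 2 * ∫⁻ x, ‖fderiv ℝ φ x‖ₑ ^ 2 ∂μ := by
    have hintegrable : Integrable (fun x => ‖fderiv ℝ φ x‖ ^ 2) μ :=
      integrable_sq_of_hasCompactSupport (hφ.continuous_fderiv one_ne_zero).norm (hc.fderiv ℝ).norm
    rw [ENNReal.ofReal_mul (by positivity), ENNReal.ofReal_mul measureReal_nonneg,
      ofReal_measureReal measure_ball_lt_top.ne, ENNReal.ofReal_pow hR0,
      ofReal_integral_eq_lintegral_ofReal hintegrable (.of_forall fun x => by positivity)]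
    simp_rw [ENNReal.ofReal_pow (norm_nonneg _), ofReal_norm]
  rw [← ENNReal.ofReal_le_ofReal_iff (by positivity), hgrad]
  calc _ ≤ ∑ k ∈ s, ENNReal.ofReal
        (2 * (μ.real (A k) * (∫ x in A k, φ x ^ 2 ∂μ) - (∫ x in A k, φ x ∂μ) ^ 2)) :=
        Finset.le_sum_of_subadditive _ ENNReal.ofReal_zero.le (fun _ _ => ENNReal.ofReal_add_le) _ _
    _ = ∑ k ∈ s, ∫⁻ x in A k, ∫⁻ y in A k, ‖φ y - φ x‖ₑ ^ 2 ∂μ ∂μ := Finset.sum_congr rfl hvar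
    _ ≤ _ := sum_lintegral_enorm_sub_sq_le hφ hA hd hR

end Translation

section Cube

variable {N : ℕ} {ε : ℝ}

/-- The half-open cube of side `ε` with lower corner `ε k`: one cell of the grid on which the
Rellich theorem is discretised. -/
def cube (ε : ℝ) (k : Fin N → ℤ) : Set (Eucl N) := {x | ∀ i, ⌊x i / ε⌋ = k i}

lemma measurableSet_cube (ε : ℝ) (k : Fin N → ℤ) : MeasurableSet (cube ε k) := by
  simp only [cube, Set.ofPred_forall]
  refine MeasurableSet.iInter fun i => ?_
  have hfloor : Measurable fun x : Eucl N => ⌊x i / ε⌋ := by fun_prop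
  exact hfloor (measurableSet_singleton (k i))

lemma pairwise_disjoint_cube : Pairwise (Function.onFun Disjoint (cube (N := N) ε)) :=
  fun _ _ hkl => Set.disjoint_left.2 fun _ hx hy =>
    hkl (funext fun i => (hx i).symm.trans (hy i))

lemma measureReal_cube (hε : 0 < ε) (k : Fin N → ℤ) : volume.real (cube ε k) = ε ^ N := by
  have hpi : cube ε k = (WithLp.ofLp : Eucl N → Fin N → ℝ) ⁻¹'
      (univ.pi fun i => Ico (ε * k i) (ε * (k i + 1))) := by
    ext x
    simp only [cube, Set.mem_ofPred_eq, mem_preimage, Set.mem_pi, mem_univ, true_imp_iff, mem_Ico,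
      Int.floor_eq_iff, le_div_iff₀ hε, div_lt_iff₀ hε, mul_comm ε]
  have hvol : volume (cube ε k) = ENNReal.ofReal (ε ^ N) := by
    rw [hpi, (PiLp.volume_preserving_ofLp (Fin N)).measure_preimage
      (MeasurableSet.univ_pi fun i => measurableSet_Ico).nullMeasurableSet, Real.volume_pi_Ico]
    simp [mul_add, ENNReal.ofReal_pow hε.le]
  rw [measureReal_def, hvol, ENNReal.toReal_ofReal (by positivity)]

lemma cube_subset_ball (hε : 0 < ε) {k : Fin N → ℤ} {x : Eucl N} (hx : x ∈ cube ε k) :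
    cube ε k ⊆ Metric.ball x ((N + 1) * ε) := by
  intro y hy
  have hcoord : ∀ i, |(y - x) i| ≤ ε := by
    intro i
    have hlt := Int.abs_sub_lt_one_of_floor_eq_floor ((hy i).trans (hx i).symm)
    rw [← sub_div, abs_div, abs_of_pos hε, div_lt_one hε] at hlt
    exact hlt.le
  have hnorm : ‖y - x‖ ^ 2 ≤ N * ε ^ 2 := by
    rw [EuclideanSpace.norm_sq_eq]
    calc _ ≤ ∑ _i : Fin N, ε ^ 2 := Finset.sum_le_sum fun i _ => by
          rw [Real.norm_eq_abs]; exact pow_le_pow_left₀ (abs_nonneg _) (hcoord i) 2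
      _ = _ := by simp
  rw [Metric.mem_ball, dist_eq_norm]
  refine lt_of_pow_lt_pow_left₀ 2 (by positivity) (hnorm.trans_lt ?_)
  rw [mul_pow]
  gcongr
  nlinarith [N.cast_nonneg (α := ℝ)]

lemma exists_subset_biUnion_cube (hε : 0 < ε) {Ω : Set (Eucl N)} (hΩb : Bornology.IsBounded Ω) :
    ∃ s : Finset (Fin N → ℤ), Ω ⊆ ⋃ k ∈ s, cube ε k := by
  obtain ⟨R, hR⟩ := hΩb.exists_norm_le
  refine ⟨Fintype.piFinset fun _ => Finset.Icc ⌊-R / ε⌋ ⌊R / ε⌋, fun x hx => ?_⟩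
  have hcoord : ∀ i, |x i| ≤ R := fun i => (PiLp.norm_apply_le x i).trans (hR x hx)
  simp only [mem_iUnion, exists_prop, Fintype.mem_piFinset, Finset.mem_Icc]
  exact ⟨fun i => ⌊x i / ε⌋,
    fun i => ⟨Int.floor_mono (by gcongr; exact (abs_le.1 (hcoord i)).1),
      Int.floor_mono (by gcongr; exact (abs_le.1 (hcoord i)).2)⟩, fun i => rfl⟩

lemma two_mul_integral_sq_le (hε : 0 < ε) {s : Finset (Fin N → ℤ)} {φ : Eucl N → ℝ}
    (hφ : ContDiff ℝ 1 φ) (hc : HasCompactSupport φ)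
    (hs : Function.support φ ⊆ ⋃ k ∈ s, cube ε k) :
    2 * ε ^ N * ∫ x, φ x ^ 2 ≤ 2 * ∑ k ∈ s, (∫ x in cube ε k, φ x) ^ 2 +
      volume.real (Metric.ball (0 : Eucl N) 1) * ((N + 1) * ε) ^ (N + 2) *
        ∫ x, ‖fderiv ℝ φ x‖ ^ 2 := by
  have hdisj : (s : Set (Fin N → ℤ)).PairwiseDisjoint (cube (N := N) ε) :=
    pairwise_disjoint_cube.set_pairwise _
  have hsplit : ∫ x, φ x ^ 2 = ∑ k ∈ s, ∫ x in cube ε k, φ x ^ 2 := by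
    rw [← integral_biUnion_finset s (fun k _ => measurableSet_cube ε k) hdisj (fun k _ =>
      (integrable_sq_of_hasCompactSupport hφ.continuous hc).integrableOn)]
    refine (setIntegral_eq_integral_of_forall_compl_eq_zero fun x hx => ?_).symm
    rw [Function.notMem_support.1 fun h => hx (hs h), zero_pow two_ne_zero]
  have hball : volume.real (Metric.ball (0 : Eucl N) ((N + 1) * ε)) =
      ((N + 1) * ε) ^ N * volume.real (Metric.ball (0 : Eucl N) 1) := by
    rw [measureReal_def, Measure.addHaar_ball_of_pos _ _ (by positivity), ENNReal.toReal_mul,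
      ENNReal.toReal_ofReal (by positivity), finrank_euclideanSpace_fin, ← measureReal_def]
  have poincare := sum_measureReal_mul_integral_sq_sub_le (μ := volume) hφ hc
    (fun k _ => measurableSet_cube ε k) hdisj (by positivity : 0 ≤ ((N : ℝ) + 1) * ε)
    (fun k _ x hx => cube_subset_ball hε hx)
  simp only [measureReal_cube hε] at poincare
  rw [← Finset.mul_sum, Finset.sum_sub_distrib, ← Finset.mul_sum, ← hsplit, hball] at poincare
  linear_combination poincare

end Cube

section Rellich

lemma norm_sq_Lp_two {α F : Type*} [MeasurableSpace α] {μ : Measure α} [NormedAddCommGroup F]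
    [InnerProductSpace ℝ F] (f : Lp F 2 μ) : ‖f‖ ^ 2 = ∫ x, ‖f x‖ ^ 2 ∂μ := by
  simp only [← real_inner_self_eq_norm_sq, L2.inner_def]

variable {N : ℕ} {Ω : Set (Eucl N)}

/-- The embedding `H₀¹(Ω) → L²(Ω)`. -/
def toL2 (Ω : Set (Eucl N)) : H01 Ω →L[ℝ] Lp ℝ 2 (vol Ω) :=
  (WithLp.fstL 2 ℝ (Lp ℝ 2 (vol Ω)) (Lp (Eucl N) 2 (vol Ω))).comp (H01 Ω).subtypeL

/-- The weak gradient of an element of `H₀¹(Ω)`, as an element of `L²(Ω)`. -/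
def gradL2 (Ω : Set (Eucl N)) : H01 Ω →L[ℝ] Lp (Eucl N) 2 (vol Ω) :=
  (WithLp.sndL 2 ℝ (Lp ℝ 2 (vol Ω)) (Lp (Eucl N) 2 (vol Ω))).comp (H01 Ω).subtypeL

lemma coeFn_toL2 (u : H01 Ω) : (toL2 Ω u : Eucl N → ℝ) = val u := rfl

lemma norm_sq_eq_add (u : H01 Ω) : ‖u‖ ^ 2 = ‖toL2 Ω u‖ ^ 2 + ‖gradL2 Ω u‖ ^ 2 :=
  WithLp.prod_norm_sq_eq_of_L2 (u : L2Pair Ω)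

lemma norm_sq_toL2 (u : H01 Ω) : ‖toL2 Ω u‖ ^ 2 = ∫ x, val u x ^ 2 ∂(vol Ω) := by
  simp only [norm_sq_Lp_two, coeFn_toL2, Real.norm_eq_abs, sq_abs]

lemma norm_sq_gradL2 (u : H01 Ω) : ‖gradL2 Ω u‖ ^ 2 = ∫ x, ‖grad u x‖ ^ 2 ∂(vol Ω) :=
  norm_sq_Lp_two _

lemma two_mul_norm_fst_sq_le {ε : ℝ} (hε : 0 < ε) {s : Finset (Fin N → ℤ)}
    (hs : Ω ⊆ ⋃ k ∈ s, cube ε k) {p : L2Pair Ω} (hp : p ∈ testPairs Ω) :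
    2 * ε ^ N * ‖p.fst‖ ^ 2 ≤ 2 * ∑ k ∈ s, (∫ x in cube ε k, p.fst x ∂(vol Ω)) ^ 2 +
      volume.real (Metric.ball (0 : Eucl N) 1) * ((N + 1) * ε) ^ (N + 2) * ‖p.snd‖ ^ 2 := by
  obtain ⟨φ, hφ, hc, hsupp, hfst, hsnd⟩ := hp
  have hzero : ∀ x ∉ Ω, φ x = 0 ∧ fderiv ℝ φ x = 0 := fun x hx =>
    ⟨image_eq_zero_of_notMem_tsupport fun h => hx (hsupp h),
      Function.notMem_support.1 fun h => hx (hsupp (support_fderiv_subset ℝ h))⟩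
  have hfst_norm : ‖p.fst‖ ^ 2 = ∫ x, φ x ^ 2 := by
    rw [norm_sq_Lp_two]
    refine (integral_congr_ae (hfst.mono fun x hx => ?_)).trans
      (setIntegral_eq_integral_of_forall_compl_eq_zero (f := fun x => φ x ^ 2) fun x hx => ?_)
    · simp only [hx, Real.norm_eq_abs, sq_abs]
    · rw [(hzero x hx).1, zero_pow two_ne_zero]
  have hsnd_norm : ‖p.snd‖ ^ 2 = ∫ x, ‖fderiv ℝ φ x‖ ^ 2 := by
    rw [norm_sq_Lp_two]
    refine (integral_congr_ae (hsnd.mono fun x hx => ?_)).trans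
      (setIntegral_eq_integral_of_forall_compl_eq_zero (f := fun x => ‖fderiv ℝ φ x‖ ^ 2)
        fun x hx => ?_)
    · simp only [hx, gradient, LinearIsometryEquiv.norm_map]
    · rw [(hzero x hx).2, norm_zero, zero_pow two_ne_zero]
  have hmean : ∀ k, ∫ x in cube ε k, p.fst x ∂(vol Ω) = ∫ x in cube ε k, φ x := fun k => by
    rw [integral_congr_ae (ae_restrict_of_ae hfst), Measure.restrict_restrict
      (measurableSet_cube ε k)]
    exact (setIntegral_eq_of_subset_of_forall_sdiff_eq_zero (measurableSet_cube ε k)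
      inter_subset_left fun x hx => (hzero x fun h => hx.2 ⟨hx.1, h⟩).1).symm
  simp_rw [hfst_norm, hsnd_norm, hmean]
  exact two_mul_integral_sq_le hε (hφ.of_le (by simp)) hc
    (((subset_tsupport φ).trans hsupp).trans hs)

lemma two_mul_norm_toL2_sq_le {ε : ℝ} (hε : 0 < ε) {s : Finset (Fin N → ℤ)}
    (hs : Ω ⊆ ⋃ k ∈ s, cube ε k) {g : (Fin N → ℤ) → Lp ℝ 2 (vol Ω) →L[ℝ] ℝ}
    (hg : ∀ k p, g k p = ∫ x in cube ε k, p x ∂(vol Ω)) (u : H01 Ω) :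
    2 * ε ^ N * ‖toL2 Ω u‖ ^ 2 ≤ 2 * ∑ k ∈ s, g k (toL2 Ω u) ^ 2 +
      volume.real (Metric.ball (0 : Eucl N) 1) * ((N + 1) * ε) ^ (N + 2) * ‖gradL2 Ω u‖ ^ 2 := by
  have hclosed : IsClosed {p : L2Pair Ω | 2 * ε ^ N * ‖p.fst‖ ^ 2 ≤ 2 * ∑ k ∈ s, g k p.fst ^ 2 +
      volume.real (Metric.ball (0 : Eucl N) 1) * ((N + 1) * ε) ^ (N + 2) * ‖p.snd‖ ^ 2} := by
    have : Continuous fun p : L2Pair Ω => p.fst := (WithLp.prod_continuous_ofLp 2 _ _).fst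
    have : Continuous fun p : L2Pair Ω => p.snd := (WithLp.prod_continuous_ofLp 2 _ _).snd
    exact isClosed_le (by fun_prop) (by fun_prop)
  refine closure_minimal (fun p hp => ?_) hclosed u.2
  simp only [Set.mem_ofPred_eq, hg]
  exact two_mul_norm_fst_sq_le hε hs hp

theorem exists_norm_toL2_sq_le (hΩb : Bornology.IsBounded Ω) {δ : ℝ} (hδ : 0 < δ) :
    ∃ (κ : Type) (s : Finset κ) (f : κ → H01 Ω →L[ℝ] ℝ) (K : ℝ), ∀ u : H01 Ω,
      ‖toL2 Ω u‖ ^ 2 ≤ δ * ‖u‖ ^ 2 + K * ∑ k ∈ s, f k u ^ 2 := by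
  set v := volume.real (Metric.ball (0 : Eucl N) 1) with hv
  obtain ⟨ε, hεδ, hε⟩ : ∃ ε : ℝ, v * (N + 1) ^ (N + 2) * ε ^ 2 < 2 * δ ∧ 0 < ε := by
    have hlim : Tendsto (fun ε : ℝ => v * (N + 1) ^ (N + 2) * ε ^ 2) (𝓝[>] 0) (𝓝 0) := by
      have hcont : Continuous fun ε : ℝ => v * (N + 1) ^ (N + 2) * ε ^ 2 := by fun_prop
      simpa using (hcont.tendsto 0).mono_left nhdsWithin_le_nhds
    exact ((hlim.eventually_lt_const (by positivity)).and self_mem_nhdsWithin).exists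
  obtain ⟨s, hs⟩ := exists_subset_biUnion_cube hε hΩb
  have := isFiniteMeasure_vol hΩb
  let g : (Fin N → ℤ) → Lp ℝ 2 (vol Ω) →L[ℝ] ℝ := fun k => innerSL ℝ
    (indicatorConstLp 2 (measurableSet_cube ε k) (measure_ne_top (vol Ω) _) (1 : ℝ))
  have hg : ∀ k p, g k p = ∫ x in cube ε k, p x ∂(vol Ω) := fun k p =>
    L2.inner_indicatorConstLp_one (measurableSet_cube ε k) (measure_ne_top (vol Ω) _) p
  refine ⟨_, s, fun k => (g k).comp (toL2 Ω), (ε ^ N)⁻¹, fun u => ?_⟩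
  have hgrad : ‖gradL2 Ω u‖ ^ 2 ≤ ‖u‖ ^ 2 := by
    rw [norm_sq_eq_add u]
    exact le_add_of_nonneg_left (sq_nonneg _)
  rw [← mul_le_mul_iff_right₀ (by positivity : 0 < 2 * ε ^ N)]
  calc _ ≤ _ := two_mul_norm_toL2_sq_le hε hs hg u
    _ = 2 * (∑ k ∈ s, g k (toL2 Ω u) ^ 2) +
        ε ^ N * ((v * (N + 1) ^ (N + 2) * ε ^ 2) * ‖gradL2 Ω u‖ ^ 2) := by
          rw [← hv, mul_pow]
          ring
    _ ≤ 2 * (∑ k ∈ s, g k (toL2 Ω u) ^ 2) + ε ^ N * ((2 * δ) * ‖u‖ ^ 2) := by gcongr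
    _ = _ := by simp only [ContinuousLinearMap.comp_apply]; field_simp; ring

end Rellich

section WeakConvergence

variable {H : Type*} [NormedAddCommGroup H] [NormedSpace ℝ H] {ι : Type*} {l : Filter ι}
  {w : ι → H} {u : H}

/-- Weak convergence of `w` to `u` along the filter `l`, tested against the continuous linear
functionals. -/
def WeaklyTendsto (w : ι → H) (l : Filter ι) (u : H) : Prop :=
  ∀ f : H →L[ℝ] ℝ, Tendsto (fun n => f (w n)) l (𝓝 (f u))

-- The hypothesis on `L` says that its restriction to bounded sets is uniformly approximated by
-- maps of finite rank, as is the case for a compact embedding into `L²`.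
lemma WeaklyTendsto.tendsto_of_finite_rank_approx {F : Type*} [NormedAddCommGroup F]
    [NormedSpace ℝ F] {L : H →L[ℝ] F}
    (hL : ∀ δ > 0, ∃ (κ : Type) (s : Finset κ) (f : κ → H →L[ℝ] ℝ) (K : ℝ), ∀ v,
      ‖L v‖ ^ 2 ≤ δ * ‖v‖ ^ 2 + K * ∑ k ∈ s, f k v ^ 2)
    {R : ℝ} (hw : WeaklyTendsto w l u) (hR : ∀ᶠ n in l, ‖w n‖ ≤ R) :
    Tendsto (fun n => L (w n)) l (𝓝 (L u)) := by
  rw [tendsto_iff_norm_sub_tendsto_zero]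
  suffices hsq : Tendsto (fun n => ‖L (w n - u)‖ ^ 2) l (𝓝 0) by
    simpa only [map_sub, Real.sqrt_sq (norm_nonneg _), Real.sqrt_zero] using hsq.sqrt
  refine Metric.tendsto_nhds.2 fun η hη => ?_
  obtain ⟨D, hD0, hRD⟩ : ∃ D : ℝ, 0 < D ∧ (|R| + ‖u‖) ^ 2 ≤ D :=
    ⟨(|R| + ‖u‖) ^ 2 + 1, by positivity, (lt_add_one _).le⟩
  obtain ⟨κ, s, f, K, hL⟩ := hL (η / (2 * D)) (by positivity)
  have hsum : Tendsto (fun n => K * ∑ k ∈ s, f k (w n - u) ^ 2) l (𝓝 0) := by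
    have hf : ∀ k, Tendsto (fun n => f k (w n - u)) l (𝓝 0) := fun k => by
      simpa only [map_sub, sub_self] using (hw (f k)).sub_const (f k u)
    simpa using (tendsto_finsetSum s fun k _ => (hf k).pow 2).const_mul K
  filter_upwards [hR, hsum.eventually_lt_const (half_pos hη)] with n hn hfin
  have hD : ‖w n - u‖ ^ 2 ≤ D := by
    have : ‖w n - u‖ ≤ |R| + ‖u‖ :=
      (norm_sub_le _ _).trans (by gcongr; exact hn.trans (le_abs_self R))
    exact (pow_le_pow_left₀ (norm_nonneg _) this 2).trans hRD
  rw [Real.dist_0_eq_abs, abs_of_nonneg (by positivity)]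
  calc ‖L (w n - u)‖ ^ 2
      ≤ η / (2 * D) * ‖w n - u‖ ^ 2 + K * ∑ k ∈ s, f k (w n - u) ^ 2 := hL _
    _ < η / (2 * D) * D + η / 2 := add_lt_add_of_le_of_lt (by gcongr) hfin
    _ = η := by field_simp; ring

theorem WeaklyTendsto.tendsto_toL2 {N : ℕ} {Ω : Set (Eucl N)} {w : ι → H01 Ω} {u : H01 Ω} {R : ℝ}
    (hw : WeaklyTendsto w l u) (hΩb : Bornology.IsBounded Ω) (hR : ∀ᶠ n in l, ‖w n‖ ≤ R) :
    Tendsto (fun n => toL2 Ω (w n)) l (𝓝 (toL2 Ω u)) :=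
  hw.tendsto_of_finite_rank_approx (fun _ hδ => exists_norm_toL2_sq_le hΩb hδ) hR

end WeakConvergence

section FourthPower

instance : Fact ((1 : ℝ≥0∞) ≤ 4) := ⟨by norm_num⟩

lemma eLpNorm_four_pow_le {α : Type*} [MeasurableSpace α] {μ : Measure α} {f : α → ℝ}
    (hf : AEStronglyMeasurable f μ) :
    eLpNorm f 4 μ ^ 4 ≤ eLpNorm f 2 μ * eLpNorm f 6 μ ^ 3 := by
  have holder := ENNReal.lintegral_mul_le_Lp_mul_Lq μ Real.HolderConjugate.two_two hf.enorm
    (hf.enorm.pow_const 3)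
  rw [eLpNorm_eq_lintegral_rpow_enorm_toReal (by norm_num) (by norm_num),
    eLpNorm_eq_lintegral_rpow_enorm_toReal (by norm_num) (by norm_num),
    eLpNorm_eq_lintegral_rpow_enorm_toReal (by norm_num) (by norm_num),
    ← ENNReal.rpow_natCast, ← ENNReal.rpow_natCast, ← ENNReal.rpow_mul, ← ENNReal.rpow_mul]
  simp only [Pi.mul_apply, ENNReal.rpow_ofNat, ENNReal.toReal_ofNat, ← pow_succ', ← pow_mul,
    Nat.cast_ofNat] at holder ⊢
  norm_num at holder ⊢
  exact holder

variable {N : ℕ} {Ω : Set (Eucl N)}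

lemma norm_toL2_le (u : H01 Ω) : ‖toL2 Ω u‖ ≤ ‖u‖ :=
  le_of_sq_le_sq ((le_add_of_nonneg_right (sq_nonneg _)).trans_eq (norm_sq_eq_add u).symm)
    (norm_nonneg _)

lemma norm_gradL2_le (u : H01 Ω) : ‖gradL2 Ω u‖ ≤ ‖u‖ :=
  le_of_sq_le_sq ((le_add_of_nonneg_left (sq_nonneg _)).trans_eq (norm_sq_eq_add u).symm)
    (norm_nonneg _)

lemma ofReal_norm_toL2 (u : H01 Ω) :
    ENNReal.ofReal ‖toL2 Ω u‖ = eLpNorm (val u) 2 (vol Ω) := by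
  rw [ofReal_norm, Lp.enorm_def, coeFn_toL2]

lemma ofReal_norm_gradL2 (u : H01 Ω) :
    ENNReal.ofReal ‖gradL2 Ω u‖ = eLpNorm (grad u) 2 (vol Ω) := by
  rw [ofReal_norm, Lp.enorm_def]
  rfl

theorem exists_eLpNorm_four_val_pow_le (hN : 1 ≤ N) (hN3 : N ≤ 3)
    (hΩb : Bornology.IsBounded Ω) : ∃ C : ℝ, 0 ≤ C ∧ ∀ u : H01 Ω,
      eLpNorm (val u) 4 (vol Ω) ^ 4 ≤ ENNReal.ofReal (‖toL2 Ω u‖ * (C * ‖u‖) ^ 3) := by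
  obtain ⟨C, hC, hsob⟩ := exists_eLpNorm_six_val_le hN hN3 hΩb
  refine ⟨C.toReal, ENNReal.toReal_nonneg, fun u => ?_⟩
  have hsix : eLpNorm (val u) 6 (vol Ω) ≤ ENNReal.ofReal (C.toReal * ‖u‖) := by
    rw [ENNReal.ofReal_mul ENNReal.toReal_nonneg, ENNReal.ofReal_toReal hC]
    refine (hsob u).trans (mul_le_mul_right ?_ C)
    rw [← ofReal_norm_gradL2]
    exact ENNReal.ofReal_le_ofReal (norm_gradL2_le u)
  rw [ENNReal.ofReal_mul (norm_nonneg _), ENNReal.ofReal_pow (by positivity), ofReal_norm_toL2]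
  exact (eLpNorm_four_pow_le (aestronglyMeasurable_val u)).trans
    (mul_le_mul_right (pow_le_pow_left₀ (zero_le) hsix 3) _)

/-- `T` is the embedding of `H₀¹(Ω)` into `L⁴(Ω)`. -/
def IsL4Embedding (T : H01 Ω →L[ℝ] Lp ℝ 4 (vol Ω)) : Prop :=
  ∀ u, T u =ᵐ[vol Ω] val u

lemma IsL4Embedding.norm_eq {T : H01 Ω →L[ℝ] Lp ℝ 4 (vol Ω)} (hT : IsL4Embedding T) (u : H01 Ω) :
    ‖T u‖ = (eLpNorm (val u) 4 (vol Ω)).toReal := by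
  rw [Lp.norm_def, eLpNorm_congr_ae (hT u)]

theorem exists_isL4Embedding (hN : 1 ≤ N) (hN3 : N ≤ 3) (hΩb : Bornology.IsBounded Ω) :
    ∃ T : H01 Ω →L[ℝ] Lp ℝ 4 (vol Ω), IsL4Embedding T := by
  obtain ⟨C, hC, hfour⟩ := exists_eLpNorm_four_val_pow_le hN hN3 hΩb
  have hmem : ∀ u : H01 Ω, MemLp (val u) 4 (vol Ω) := fun u =>
    ⟨aestronglyMeasurable_val u, (ENNReal.pow_lt_top_iff.1
      ((hfour u).trans_lt ENNReal.ofReal_lt_top)).resolve_right four_ne_zero⟩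
  let T : H01 Ω →ₗ[ℝ] Lp ℝ 4 (vol Ω) :=
    { toFun := fun u => (hmem u).toLp
      map_add' := fun u v => by
        rw [← MemLp.toLp_add]
        exact MemLp.toLp_congr _ _ (Lp.coeFn_add (toL2 Ω u) (toL2 Ω v))
      map_smul' := fun c u => by
        rw [RingHom.id_apply, ← MemLp.toLp_const_smul]
        exact MemLp.toLp_congr _ _ (Lp.coeFn_smul c (toL2 Ω u)) }
  have hbound : ∀ u, ‖T u‖ ≤ (1 + C) * ‖u‖ := fun u => by
    refine le_of_pow_le_pow_left₀ four_ne_zero (by positivity) ?_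
    calc ‖T u‖ ^ 4 = (eLpNorm (val u) 4 (vol Ω) ^ 4).toReal := by
          rw [ENNReal.toReal_pow, ← Lp.norm_toLp _ (hmem u)]
          rfl
      _ ≤ ‖toL2 Ω u‖ * (C * ‖u‖) ^ 3 := ENNReal.toReal_le_of_le_ofReal (by positivity) (hfour u)
      _ ≤ ((1 + C) * ‖u‖) * ((1 + C) * ‖u‖) ^ 3 := by
          gcongr
          · exact (norm_toL2_le u).trans (le_mul_of_one_le_left (norm_nonneg u) (by linarith))
          · linarith
      _ = ((1 + C) * ‖u‖) ^ 4 := by ring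
  exact ⟨T.mkContinuous _ hbound, fun u => (hmem u).coeFn_toLp⟩

theorem IsL4Embedding.tendsto_of_weaklyTendsto {T : H01 Ω →L[ℝ] Lp ℝ 4 (vol Ω)}
    (hT : IsL4Embedding T) (hN : 1 ≤ N) (hN3 : N ≤ 3) (hΩb : Bornology.IsBounded Ω) {ι : Type*}
    {l : Filter ι} {w : ι → H01 Ω} {u : H01 Ω} {R : ℝ} (hw : WeaklyTendsto w l u)
    (hR : ∀ᶠ n in l, ‖w n‖ ≤ R) : Tendsto (fun n => T (w n)) l (𝓝 (T u)) := by
  obtain ⟨C, hC, hfour⟩ := exists_eLpNorm_four_val_pow_le hN hN3 hΩb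
  have hbound : ∀ v : H01 Ω, ‖T v‖ ^ 4 ≤ ‖toL2 Ω v‖ * (C * ‖v‖) ^ 3 := fun v => by
    rw [hT.norm_eq, ← ENNReal.toReal_pow]
    exact ENNReal.toReal_le_of_le_ofReal (by positivity) (hfour v)
  have hL2 : Tendsto (fun n => ‖toL2 Ω (w n - u)‖ * (C * (R + ‖u‖)) ^ 3) l (𝓝 0) := by
    simpa only [map_sub, zero_mul] using
      (tendsto_iff_norm_sub_tendsto_zero.1 (hw.tendsto_toL2 hΩb hR)).mul_const
        ((C * (R + ‖u‖)) ^ 3)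
  have hpow : Tendsto (fun n => ‖T (w n - u)‖ ^ 4) l (𝓝 0) := by
    refine squeeze_zero' (.of_forall fun n => by positivity) ?_ hL2
    filter_upwards [hR] with n hn
    refine (hbound _).trans ?_
    gcongr
    exact (norm_sub_le _ _).trans (by gcongr)
  have hsqrt : ∀ n, √√(‖T (w n - u)‖ ^ 4) = ‖T (w n) - T u‖ := fun n => by
    rw [pow_mul _ 2 2, Real.sqrt_sq (by positivity), Real.sqrt_sq (norm_nonneg _), map_sub]
  rw [tendsto_iff_norm_sub_tendsto_zero]
  simpa only [hsqrt, Real.sqrt_zero] using hpow.sqrt.sqrt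

end FourthPower

/-! ### Energy densities -/

section Products

lemma tendsto_clm_apply₂ {E F G ι : Type*} [NormedAddCommGroup E] [NormedSpace ℝ E]
    [NormedAddCommGroup F] [NormedSpace ℝ F] [NormedAddCommGroup G] [NormedSpace ℝ G]
    (L : E →L[ℝ] F →L[ℝ] G) {l : Filter ι} {f : ι → E} {g : ι → F} {x : E} {y : F}
    (hf : Tendsto f l (𝓝 x)) (hg : Tendsto g l (𝓝 y)) :
    Tendsto (fun n => L (f n) (g n)) l (𝓝 (L x y)) :=
  (L.continuous₂.tendsto (x, y)).comp (hf.prodMk_nhds hg)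

instance : ENNReal.HolderTriple 4 4 2 := ⟨by
  rw [← ENNReal.toReal_eq_toReal_iff' (by simp) (by simp), ENNReal.toReal_add (by simp) (by simp)]
  norm_num⟩

variable {α : Type*} [MeasurableSpace α] {μ : Measure α}

/-- The pointwise product of an element of `L^p` and an element of `L^q`, as an element of `L^r`,
where `1/r = 1/p + 1/q`. -/
def lpMul (μ : Measure α) (p q r : ℝ≥0∞) [Fact (1 ≤ p)] [Fact (1 ≤ q)] [Fact (1 ≤ r)]
    [ENNReal.HolderTriple p q r] : Lp ℝ p μ →L[ℝ] Lp ℝ q μ →L[ℝ] Lp ℝ r μ :=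
  (ContinuousLinearMap.mul ℝ ℝ).holderL μ p q r

section HolderTriple

variable {p q r : ℝ≥0∞} [Fact (1 ≤ p)] [Fact (1 ≤ q)] [Fact (1 ≤ r)]
  [ENNReal.HolderTriple p q r]

lemma coeFn_lpMul (f : Lp ℝ p μ) (g : Lp ℝ q μ) :
    lpMul μ p q r f g =ᵐ[μ] fun x => f x * g x :=
  (ContinuousLinearMap.mul ℝ ℝ).coeFn_holder f g

lemma norm_lpMul_le (f : Lp ℝ p μ) (g : Lp ℝ q μ) : ‖lpMul μ p q r f g‖ ≤ ‖f‖ * ‖g‖ := by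
  have h := (ContinuousLinearMap.mul ℝ ℝ).norm_holder_apply_apply_le (r := r) f g
  rwa [ContinuousLinearMap.opNorm_mul, one_mul] at h

lemma tendsto_lpMul {ι : Type*} {l : Filter ι} {f : ι → Lp ℝ p μ} {g : ι → Lp ℝ q μ}
    {f' : Lp ℝ p μ} {g' : Lp ℝ q μ} (hf : Tendsto f l (𝓝 f')) (hg : Tendsto g l (𝓝 g')) :
    Tendsto (fun n => lpMul μ p q r (f n) (g n)) l (𝓝 (lpMul μ p q r f' g')) :=
  tendsto_clm_apply₂ (lpMul μ p q r) hf hg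

end HolderTriple

lemma inner_lpMul_ae_eq (β : Lp ℝ ∞ μ) (f g : Lp ℝ 2 μ) :
    (fun x => inner ℝ (lpMul μ ∞ 2 2 β f x) (g x)) =ᵐ[μ] fun x => β x * f x * g x := by
  filter_upwards [coeFn_lpMul (r := 2) β f] with x hx
  rw [hx, RCLike.inner_apply, conj_trivial, mul_comm]

lemma integrable_mul_mul (β : Lp ℝ ∞ μ) (f g : Lp ℝ 2 μ) :
    Integrable (fun x => β x * f x * g x) μ :=
  (L2.integrable_inner (𝕜 := ℝ) _ g).congr (inner_lpMul_ae_eq β f g)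

lemma inner_lpMul_eq_integral (β : Lp ℝ ∞ μ) (f g : Lp ℝ 2 μ) :
    inner ℝ (lpMul μ ∞ 2 2 β f) g = ∫ x, β x * f x * g x ∂μ := by
  rw [L2.inner_def, integral_congr_ae (inner_lpMul_ae_eq β f g)]

lemma abs_integral_mul_mul_le (β : Lp ℝ ∞ μ) (f g : Lp ℝ 2 μ) :
    |∫ x, β x * f x * g x ∂μ| ≤ ‖β‖ * ‖f‖ * ‖g‖ := by
  rw [← inner_lpMul_eq_integral]
  exact (abs_real_inner_le_norm _ _).trans (by gcongr; exact norm_lpMul_le _ _)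

lemma tendsto_integral_mul_mul {ι : Type*} {l : Filter ι} {β : ι → Lp ℝ ∞ μ}
    {f g : ι → Lp ℝ 2 μ} {β' : Lp ℝ ∞ μ} {f' g' : Lp ℝ 2 μ} (hβ : Tendsto β l (𝓝 β'))
    (hf : Tendsto f l (𝓝 f')) (hg : Tendsto g l (𝓝 g')) :
    Tendsto (fun n => ∫ x, β n x * f n x * g n x ∂μ) l (𝓝 (∫ x, β' x * f' x * g' x ∂μ)) := by
  simp only [← inner_lpMul_eq_integral]
  exact (tendsto_lpMul hβ hf).inner hg

end Products

section Potential

variable {N : ℕ} {Ω : Set (Eucl N)}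

lemma integrable_norm_grad_sq (u : H01 Ω) : Integrable (fun x => ‖grad u x‖ ^ 2) (vol Ω) :=
  (memLp_grad u).norm.integrable_sq

lemma integrable_val_sq (u : H01 Ω) : Integrable (fun x => val u x ^ 2) (vol Ω) :=
  (memLp_val u).integrable_sq

lemma integrable_potential (V : LInf Ω) (u : H01 Ω) :
    Integrable (fun x => V x * val u x ^ 2) (vol Ω) := by
  simpa only [mul_assoc, ← sq, coeFn_toL2] using integrable_mul_mul V (toL2 Ω u) (toL2 Ω u)

lemma normSq_eq_norm_sq_sub_add (V : LInf Ω) (u : H01 Ω) : normSq V u =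
    ‖u‖ ^ 2 - ‖toL2 Ω u‖ ^ 2 + ∫ x, V x * toL2 Ω u x * toL2 Ω u x ∂(vol Ω) := by
  rw [normSq, integral_add (integrable_norm_grad_sq u) (integrable_potential V u),
    ← norm_sq_gradL2, norm_sq_eq_add]
  simp only [mul_assoc, ← sq, coeFn_toL2]
  ring

lemma val_smul (c : ℝ) (u : H01 Ω) : val (c • u) =ᵐ[vol Ω] fun x => c * val u x :=
  Lp.coeFn_smul c (toL2 Ω u)

lemma grad_smul (c : ℝ) (u : H01 Ω) : grad (c • u) =ᵐ[vol Ω] fun x => c • grad u x :=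
  Lp.coeFn_smul c (gradL2 Ω u)

lemma normSq_smul (V : LInf Ω) (c : ℝ) (u : H01 Ω) : normSq V (c • u) = c ^ 2 * normSq V u := by
  rw [normSq, normSq, ← integral_const_mul]
  refine integral_congr_ae ?_
  filter_upwards [val_smul c u, grad_smul c u] with x hval hgrad
  rw [hval, hgrad, norm_smul, mul_pow, Real.norm_eq_abs, sq_abs]
  ring

lemma abs_normSq_sub_normSq_le (V W : LInf Ω) (u : H01 Ω) :
    |normSq V u - normSq W u| ≤ ‖V - W‖ * ‖u‖ ^ 2 := by
  have hsub : normSq V u - normSq W u =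
      ∫ x, (V - W) x * toL2 Ω u x * toL2 Ω u x ∂(vol Ω) := by
    rw [normSq_eq_norm_sq_sub_add, normSq_eq_norm_sq_sub_add, add_sub_add_left_eq_sub,
      ← integral_sub (integrable_mul_mul V _ _) (integrable_mul_mul W _ _)]
    refine integral_congr_ae ?_
    filter_upwards [Lp.coeFn_sub V W] with x hx
    rw [hx, Pi.sub_apply, sub_mul, sub_mul]
  rw [hsub, sq, ← mul_assoc]
  refine (abs_integral_mul_mul_le _ _ _).trans ?_
  gcongr <;> exact norm_toL2_le u

lemma tendsto_normSq {ι : Type*} {l : Filter ι} {V : ι → LInf Ω} {V' : LInf Ω} {u : ι → H01 Ω}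
    {u' : H01 Ω} {e : ℝ} (hV : Tendsto V l (𝓝 V'))
    (hL2 : Tendsto (fun n => toL2 Ω (u n)) l (𝓝 (toL2 Ω u')))
    (hnorm : Tendsto (fun n => ‖u n‖ ^ 2) l (𝓝 (‖u'‖ ^ 2 + e))) :
    Tendsto (fun n => normSq (V n) (u n)) l (𝓝 (normSq V' u' + e)) := by
  simp only [normSq_eq_norm_sq_sub_add]
  convert (hnorm.sub (hL2.norm.pow 2)).add (tendsto_integral_mul_mul hV hL2 hL2) using 2
  ring

end Potential

section Coupling

variable {N : ℕ} {Ω : Set (Eucl N)}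

/-- `∫ u² v²`, which vanishes exactly when `u` and `v` are segregated. -/
def overlap (u v : H01 Ω) : ℝ :=
  ∫ x, val u x ^ 2 * val v x ^ 2 ∂(vol Ω)

lemma overlap_nonneg (u v : H01 Ω) : 0 ≤ overlap u v :=
  integral_nonneg fun _ => mul_nonneg (sq_nonneg _) (sq_nonneg _)

lemma overlap_smul (s t : ℝ) (u v : H01 Ω) :
    overlap (s • u) (t • v) = s ^ 2 * t ^ 2 * overlap u v := by
  rw [overlap, overlap, ← integral_const_mul]
  refine integral_congr_ae ?_
  filter_upwards [val_smul s u, val_smul t v] with x hu hv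
  rw [hu, hv]
  ring

lemma coupling_smul (β : LInf Ω) (s t : ℝ) (u v : H01 Ω) :
    coupling β (s • u) (t • v) = s ^ 2 * t ^ 2 * coupling β u v := by
  rw [coupling, coupling, ← integral_const_mul]
  refine integral_congr_ae ?_
  filter_upwards [val_smul s u, val_smul t v] with x hu hv
  rw [hu, hv]
  ring

lemma coupling_comm (β : LInf Ω) (u v : H01 Ω) : coupling β u v = coupling β v u := by
  simp only [coupling, mul_right_comm]

lemma coupling_zero_left (u v : H01 Ω) : coupling 0 u v = 0 := by
  refine integral_eq_zero_of_ae ?_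
  filter_upwards [Lp.coeFn_zero ℝ ∞ (vol Ω)] with x hx
  simp only [hx, Pi.zero_apply, zero_mul]

lemma coupling_nonneg {β : LInf Ω} (hβ : ∀ᵐ x ∂(vol Ω), 0 ≤ β x) (u v : H01 Ω) :
    0 ≤ coupling β u v :=
  integral_nonneg_of_ae <| hβ.mono fun _ hx =>
    mul_nonneg (mul_nonneg hx (sq_nonneg _)) (sq_nonneg _)

lemma negCoupling_nonneg (β : LInf Ω) (u v : H01 Ω) : 0 ≤ negCoupling β u v :=
  integral_nonneg fun _ => mul_nonneg (le_max_right _ _) (sq_nonneg _)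

lemma negCoupling_eq_zero_of_nonneg {β : LInf Ω} (hβ : ∀ᵐ x ∂(vol Ω), 0 ≤ β x) (u v : H01 Ω) :
    negCoupling β u v = 0 := by
  refine integral_eq_zero_of_ae ?_
  filter_upwards [hβ] with x hx
  rw [max_eq_right (neg_nonpos.2 hx), zero_mul, Pi.zero_apply]

lemma negCoupling_eq_neg_coupling {β : LInf Ω} (hβ : ∀ᵐ x ∂(vol Ω), β x ≤ 0) (u v : H01 Ω) :
    negCoupling β u v = -coupling β u v := by
  rw [negCoupling, coupling, ← integral_neg]
  refine integral_congr_ae ?_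
  filter_upwards [hβ] with x hx
  rw [max_eq_left (neg_nonneg.2 hx)]
  ring

namespace IsL4Embedding

variable {T : H01 Ω →L[ℝ] Lp ℝ 4 (vol Ω)} (hT : IsL4Embedding T)
include hT

lemma lpMul_self_ae_eq (u : H01 Ω) :
    lpMul (vol Ω) 4 4 2 (T u) (T u) =ᵐ[vol Ω] fun x => val u x ^ 2 := by
  filter_upwards [coeFn_lpMul (r := 2) (T u) (T u), hT u] with x hmul hx
  rw [hmul, hx, sq]

lemma coupling_ae_eq (β : LInf Ω) (u v : H01 Ω) :
    (fun x => β x * lpMul (vol Ω) 4 4 2 (T u) (T u) x * lpMul (vol Ω) 4 4 2 (T v) (T v) x)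
      =ᵐ[vol Ω] fun x => β x * val u x ^ 2 * val v x ^ 2 := by
  filter_upwards [hT.lpMul_self_ae_eq u, hT.lpMul_self_ae_eq v] with x hu hv
  rw [hu, hv]

lemma integrable_coupling (β : LInf Ω) (u v : H01 Ω) :
    Integrable (fun x => β x * val u x ^ 2 * val v x ^ 2) (vol Ω) :=
  (integrable_mul_mul β _ _).congr (hT.coupling_ae_eq β u v)

lemma coupling_eq (β : LInf Ω) (u v : H01 Ω) : coupling β u v =
    ∫ x, β x * lpMul (vol Ω) 4 4 2 (T u) (T u) x * lpMul (vol Ω) 4 4 2 (T v) (T v) x ∂(vol Ω) :=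
  (integral_congr_ae (hT.coupling_ae_eq β u v)).symm

lemma coupling_le (β : LInf Ω) (u v : H01 Ω) :
    coupling β u v ≤ ‖β‖ * ‖T u‖ ^ 2 * ‖T v‖ ^ 2 := by
  rw [hT.coupling_eq, sq, sq]
  refine (le_abs_self _).trans ((abs_integral_mul_mul_le _ _ _).trans ?_)
  gcongr <;> exact norm_lpMul_le _ _

lemma tendsto_coupling {ι : Type*} {l : Filter ι} {β : ι → LInf Ω} {β' : LInf Ω}
    {u v : ι → H01 Ω} {u' v' : H01 Ω} (hβ : Tendsto β l (𝓝 β'))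
    (hu : Tendsto (fun n => T (u n)) l (𝓝 (T u'))) (hv : Tendsto (fun n => T (v n)) l (𝓝 (T v'))) :
    Tendsto (fun n => coupling (β n) (u n) (v n)) l (𝓝 (coupling β' u' v')) := by
  simp only [hT.coupling_eq]
  exact tendsto_integral_mul_mul hβ (tendsto_lpMul hu hu) (tendsto_lpMul hv hv)

lemma overlap_ae_eq (u v : H01 Ω) :
    (fun x => inner ℝ (lpMul (vol Ω) 4 4 2 (T u) (T u) x) (lpMul (vol Ω) 4 4 2 (T v) (T v) x))
      =ᵐ[vol Ω] fun x => val u x ^ 2 * val v x ^ 2 := by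
  filter_upwards [hT.lpMul_self_ae_eq u, hT.lpMul_self_ae_eq v] with x hu hv
  rw [hu, hv, RCLike.inner_apply, conj_trivial, mul_comm]

lemma integrable_overlap (u v : H01 Ω) :
    Integrable (fun x => val u x ^ 2 * val v x ^ 2) (vol Ω) :=
  (L2.integrable_inner (𝕜 := ℝ) _ _).congr (hT.overlap_ae_eq u v)

lemma overlap_eq_inner (u v : H01 Ω) : overlap u v =
    inner ℝ (lpMul (vol Ω) 4 4 2 (T u) (T u)) (lpMul (vol Ω) 4 4 2 (T v) (T v)) := by
  rw [overlap, L2.inner_def, integral_congr_ae (hT.overlap_ae_eq u v)]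

lemma tendsto_overlap {ι : Type*} {l : Filter ι} {u v : ι → H01 Ω} {u' v' : H01 Ω}
    (hu : Tendsto (fun n => T (u n)) l (𝓝 (T u'))) (hv : Tendsto (fun n => T (v n)) l (𝓝 (T v'))) :
    Tendsto (fun n => overlap (u n) (v n)) l (𝓝 (overlap u' v')) := by
  simp only [hT.overlap_eq_inner]
  exact (tendsto_lpMul hu hu).inner (tendsto_lpMul hv hv)

lemma val_mul_val_ae_eq_zero {u v : H01 Ω} (huv : overlap u v = 0) :
    ∀ᵐ x ∂(vol Ω), val u x * val v x = 0 := by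
  have hzero := (integral_eq_zero_iff_of_nonneg_ae
    (.of_forall fun x => mul_nonneg (sq_nonneg _) (sq_nonneg _)) (hT.integrable_overlap u v)).1 huv
  filter_upwards [hzero] with x hx
  simpa using hx

lemma coupling_eq_zero (β : LInf Ω) {u v : H01 Ω} (huv : overlap u v = 0) :
    coupling β u v = 0 := by
  refine integral_eq_zero_of_ae ?_
  filter_upwards [hT.val_mul_val_ae_eq_zero huv] with x hx
  rw [mul_assoc, ← mul_pow, hx, zero_pow two_ne_zero, mul_zero, Pi.zero_apply]

lemma negCoupling_eq_zero (β : LInf Ω) {u v : H01 Ω} (huv : overlap u v = 0) :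
    negCoupling β u v = 0 := by
  refine integral_eq_zero_of_ae ?_
  filter_upwards [hT.val_mul_val_ae_eq_zero huv] with x hx
  rw [hx, zero_pow two_ne_zero, mul_zero, Pi.zero_apply]

lemma mul_overlap_le_coupling {β : LInf Ω} {c : ℝ} (hβ : ∀ᵐ x ∂(vol Ω), c ≤ β x) (u v : H01 Ω) :
    c * overlap u v ≤ coupling β u v := by
  rw [overlap, ← integral_const_mul]
  refine integral_mono_ae ((hT.integrable_overlap u v).const_mul c)
    (hT.integrable_coupling β u v) (hβ.mono fun x hx => ?_)
  simp only [mul_assoc]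
  exact mul_le_mul_of_nonneg_right hx (mul_nonneg (sq_nonneg _) (sq_nonneg _))

lemma coupling_le_mul_overlap {β : LInf Ω} {c : ℝ} (hβ : ∀ᵐ x ∂(vol Ω), β x ≤ c) (u v : H01 Ω) :
    coupling β u v ≤ c * overlap u v := by
  rw [overlap, ← integral_const_mul]
  refine integral_mono_ae (hT.integrable_coupling β u v)
    ((hT.integrable_overlap u v).const_mul c) (hβ.mono fun x hx => ?_)
  simp only [mul_assoc]
  exact mul_le_mul_of_nonneg_right hx (mul_nonneg (sq_nonneg _) (sq_nonneg _))

lemma eq_zero_iff {u : H01 Ω} : T u = 0 ↔ val u =ᵐ[vol Ω] 0 := by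
  rw [Lp.eq_zero_iff_ae_eq_zero]
  exact ⟨(hT u).symm.trans, (hT u).trans⟩

lemma overlap_self_pos {u : H01 Ω} (hu : T u ≠ 0) : 0 < overlap u u :=
  (overlap_nonneg u u).lt_of_ne' fun h => hu <| hT.eq_zero_iff.2 <|
    (hT.val_mul_val_ae_eq_zero h).mono fun _ => mul_self_eq_zero.1

end IsL4Embedding

end Coupling

/-! ### Coercivity -/

section Coercivity

variable {N : ℕ} {Ω : Set (Eucl N)}

lemma exists_poincare (hN : 1 ≤ N) (hN3 : N ≤ 3) (hΩb : Bornology.IsBounded Ω) :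
    ∃ P : ℝ, 0 ≤ P ∧ ∀ u : H01 Ω, ‖toL2 Ω u‖ ^ 2 ≤ P * ‖gradL2 Ω u‖ ^ 2 := by
  obtain ⟨C, hC, hsobolev⟩ := exists_eLpNorm_six_val_le hN hN3 hΩb
  have := isFiniteMeasure_vol hΩb
  set D : ℝ≥0∞ := C * vol Ω univ ^ (1 / (2 : ℝ≥0∞).toReal - 1 / (6 : ℝ≥0∞).toReal) with hD
  have hD_top : D ≠ ⊤ := ENNReal.mul_ne_top hC
    (ENNReal.rpow_lt_top_of_nonneg (by norm_num) (measure_ne_top _ _)).ne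
  refine ⟨D.toReal ^ 2, sq_nonneg _, fun u => ?_⟩
  have hle : eLpNorm (val u) 2 (vol Ω) ≤ D * eLpNorm (grad u) 2 (vol Ω) := by
    refine (eLpNorm_le_eLpNorm_mul_rpow_measure_univ (q := 6) (by norm_num)
      (aestronglyMeasurable_val u)).trans ?_
    rw [hD, mul_assoc, mul_comm (_ ^ _), ← mul_assoc]
    exact mul_le_mul_left (hsobolev u) _
  rw [← mul_pow]
  gcongr
  exact (ENNReal.toReal_mono (ENNReal.mul_ne_top hD_top (memLp_grad u).2.ne) hle).trans_eq
    ENNReal.toReal_mul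

lemma firstEigenvalue_mul_le (u : H01 Ω) :
    firstEigenvalue Ω * ‖toL2 Ω u‖ ^ 2 ≤ ‖gradL2 Ω u‖ ^ 2 := by
  rcases (sq_nonneg ‖toL2 Ω u‖).eq_or_lt with hzero | hpos
  · rw [← hzero, mul_zero]
    exact sq_nonneg _
  rw [← le_div_iff₀ hpos, norm_sq_toL2, norm_sq_gradL2]
  refine csInf_le ⟨0, ?_⟩ ⟨u, ?_, rfl⟩
  · rintro _ ⟨v, -, rfl⟩
    exact div_nonneg (integral_nonneg fun x => sq_nonneg _) (integral_nonneg fun x => sq_nonneg _)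
  · rintro rfl
    simp at hpos

lemma norm_gradL2_sq_add_mul_le_normSq {V : LInf Ω} {r : ℝ} (hV : ∀ᵐ x ∂(vol Ω), r ≤ V x)
    (u : H01 Ω) : ‖gradL2 Ω u‖ ^ 2 + r * ‖toL2 Ω u‖ ^ 2 ≤ normSq V u := by
  rw [norm_sq_gradL2, norm_sq_toL2, normSq, ← integral_const_mul,
    ← integral_add (integrable_norm_grad_sq u) ((integrable_val_sq u).const_mul r)]
  refine integral_mono_ae ((integrable_norm_grad_sq u).add ((integrable_val_sq u).const_mul r))
    ((integrable_norm_grad_sq u).add (integrable_potential V u)) ?_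
  filter_upwards [hV] with x hx
  gcongr

lemma exists_mul_norm_gradL2_sq_le {r : ℝ} (hr : -firstEigenvalue Ω < r) : ∃ k : ℝ, 0 < k ∧
    ∀ u : H01 Ω, k * ‖gradL2 Ω u‖ ^ 2 ≤ ‖gradL2 Ω u‖ ^ 2 + r * ‖toL2 Ω u‖ ^ 2 := by
  rcases le_or_gt 0 r with hr0 | hr0
  · refine ⟨1, one_pos, fun u => ?_⟩
    rw [one_mul]
    exact le_add_of_nonneg_right (by positivity)
  have hpos : 0 < firstEigenvalue Ω := by linarith
  refine ⟨1 + r / firstEigenvalue Ω, ?_, fun u => ?_⟩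
  · rw [← neg_lt_iff_pos_add', lt_div_iff₀ hpos]
    linarith
  · have hscaled := mul_le_mul_of_nonpos_left (firstEigenvalue_mul_le u)
      (div_nonpos_of_nonpos_of_nonneg hr0.le hpos.le)
    rw [← mul_assoc, div_mul_cancel₀ _ hpos.ne'] at hscaled
    linarith

lemma exists_mul_norm_sq_le_normSq (hN : 1 ≤ N) (hN3 : N ≤ 3) (hΩb : Bornology.IsBounded Ω)
    {V : LInf Ω} {r : ℝ} (hr : -firstEigenvalue Ω < r) (hV : ∀ᵐ x ∂(vol Ω), r ≤ V x) :
    ∃ c : ℝ, 0 < c ∧ ∀ u : H01 Ω, c * ‖u‖ ^ 2 ≤ normSq V u := by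
  obtain ⟨P, hP, hpoincare⟩ := exists_poincare hN hN3 hΩb
  obtain ⟨k, hk, hgrad⟩ := exists_mul_norm_gradL2_sq_le hr
  refine ⟨k / (1 + P), by positivity, fun u => ?_⟩
  refine le_trans ?_ ((hgrad u).trans (norm_gradL2_sq_add_mul_le_normSq hV u))
  rw [div_mul_eq_mul_div, div_le_iff₀ (by positivity), norm_sq_eq_add u, mul_assoc]
  gcongr
  linarith [hpoincare u]

variable {d m : ℕ} {a : Fin (m + 1) → ℕ} {c : ℝ} {V V' : Fin d → LInf Ω}
  {B : Fin d → Fin d → LInf Ω}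

/-- The quadratic forms of the potentials `V i` are bounded below by `c` times the squared norm
of `H₀¹(Ω)`. -/
def IsCoercive (c : ℝ) (V : Fin d → LInf Ω) : Prop :=
  ∀ i u, c * ‖u‖ ^ 2 ≤ normSq (V i) u

lemma Admissible.exists_isCoercive (hadm : Admissible a V B) (hN : 1 ≤ N) (hN3 : N ≤ 3)
    (hΩb : Bornology.IsBounded Ω) : ∃ c, 0 < c ∧ IsCoercive c V := by
  have hcoer (i : Fin d) : ∃ c : ℝ, 0 < c ∧ ∀ u : H01 Ω, c * ‖u‖ ^ 2 ≤ normSq (V i) u :=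
    let ⟨_, hl, hV⟩ := hadm.2.1 i
    exists_mul_norm_sq_le_normSq hN hN3 hΩb hl hV
  choose c hc hcV using hcoer
  obtain ⟨c', hc', hc'_le⟩ : ∃ c' : ℝ, 0 < c' ∧ ∀ i, c' ≤ c i := by
    rcases isEmpty_or_nonempty (Fin d) with _ | _
    · exact ⟨1, one_pos, isEmptyElim⟩
    · exact (Finite.exists_min c).elim fun i hi => ⟨c i, hc i, hi⟩
  exact ⟨c', hc', fun i u => (mul_le_mul_of_nonneg_right (hc'_le i) (sq_nonneg _)).trans (hcV i u)⟩

lemma IsCoercive.of_norm_sub_le {c' : ℝ} (hV' : IsCoercive c V')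
    (hsub : ∀ i, ‖V i - V' i‖ ≤ c - c') : IsCoercive c' V := fun i u => by
  have hdiff := (abs_le.1 (abs_normSq_sub_normSq_le (V i) (V' i) u)).1
  have hbound := mul_le_mul_of_nonneg_right (hsub i) (sq_nonneg ‖u‖)
  linarith [hV' i u]

end Coercivity

section Groups

variable {m d : ℕ} {a : Fin (m + 1) → ℕ}

lemma IsDecomposition.exists_mem_group (ha : IsDecomposition m d a) (i : Fin d) :
    ∃ h, i ∈ group d a h := by
  obtain ⟨hzero, -, hlast⟩ := ha
  simp only [group, Finset.mem_filter_univ]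
  by_contra! hcon
  have hle (k : Fin (m + 1)) : a k ≤ (i : ℕ) := by
    induction k using Fin.induction with
    | zero => omega
    | succ k ih => exact hcon k ih
  exact (i.2.trans_eq hlast.symm).not_ge (hle (Fin.last m))

/-- The number of the group to which an index belongs. -/
def IsDecomposition.index (ha : IsDecomposition m d a) (i : Fin d) : Fin m :=
  (ha.exists_mem_group i).choose

namespace IsDecomposition

variable (ha : IsDecomposition m d a)

lemma mem_group_iff {i : Fin d} {h : Fin m} : i ∈ group d a h ↔ ha.index i = h := by
  have hindex : i ∈ group d a (ha.index i) := (ha.exists_mem_group i).choose_spec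
  refine ⟨fun hi => ?_, fun hi => hi ▸ hindex⟩
  simp only [group, Finset.mem_filter_univ] at hindex hi
  have hmono := ha.2.1
  have hle : ha.index i ≤ h := by
    have := hmono.lt_iff_lt.1 (hindex.1.trans_lt hi.2)
    rwa [Fin.castSucc_lt_succ_iff] at this
  have hge : h ≤ ha.index i := by
    have := hmono.lt_iff_lt.1 (hi.1.trans_lt hindex.2)
    rwa [Fin.castSucc_lt_succ_iff] at this
  exact le_antisymm hle hge

lemma mem_K2_iff {i j : Fin d} : (i, j) ∈ K2 d a ↔ ha.index i ≠ ha.index j := by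
  simp [K2, ha.mem_group_iff]

lemma group_eq_filter (h : Fin m) : group d a h = Finset.univ.filter (ha.index · = h) := by
  ext i
  simp [ha.mem_group_iff]

include ha in
lemma sum_group (f : Fin d → ℝ) : ∑ h, ∑ i ∈ group d a h, f i = ∑ i, f i := by
  simp_rw [ha.group_eq_filter]
  exact Finset.sum_fiberwise _ _ _

end IsDecomposition

end Groups

/-! ### Nehari-type sets -/

section Rescaling

variable {N : ℕ} {Ω : Set (Eucl N)} {d : ℕ}

/-- The componentwise rescaling `(s₁ u₁, …, s_d u_d)` of `u`. -/
def rescale (s : Fin d → ℝ) (u : HProd Ω d) : HProd Ω d :=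
  WithLp.toLp 2 fun i => s i • u i

lemma rescale_apply (s : Fin d → ℝ) (u : HProd Ω d) (i : Fin d) :
    rescale s u i = s i • u i := rfl

lemma energy_rescale (V : Fin d → LInf Ω) (B : Fin d → Fin d → LInf Ω) (s : Fin d → ℝ)
    (u : HProd Ω d) : energy V B (rescale s u) =
      (1 / 2) * ∑ i, s i ^ 2 * normSq (V i) (u i) -
        (1 / 4) * ∑ i, ∑ j, s i ^ 2 * s j ^ 2 * coupling (B i j) (u i) (u j) := by
  simp only [energy, rescale_apply, normSq_smul, coupling_smul]

lemma add_smul_single_eq_rescale (u : HProd Ω d) (i : Fin d) (t : ℝ) :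
    u + t • PiLp.single 2 i (u i) = rescale (fun j => 1 + t * if j = i then 1 else 0) u := by
  ext1 j
  rcases eq_or_ne j i with rfl | hj
  · simp [rescale_apply, add_smul]
  · simp [rescale_apply, hj]

lemma hasDerivAt_energy_rescale (V : Fin d → LInf Ω) {B : Fin d → Fin d → LInf Ω}
    (hB : ∀ i j, B i j = B j i) (u : HProd Ω d) (ρ : Fin d → ℝ) :
    HasDerivAt (fun t : ℝ => energy V B (rescale (fun i => 1 + t * ρ i) u))
      (∑ i, ρ i * (normSq (V i) (u i) - ∑ j, coupling (B i j) (u i) (u j))) 0 := by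
  have hsq (r : ℝ) : HasDerivAt (fun t : ℝ => (1 + t * r) ^ 2) (2 * r) 0 := by
    simpa using (((hasDerivAt_id (0 : ℝ)).mul_const r).const_add 1).fun_pow 2
  have hsq_mul (r r' : ℝ) : HasDerivAt (fun t : ℝ => (1 + t * r) ^ 2 * (1 + t * r') ^ 2)
      (2 * r + 2 * r') 0 := by
    simpa using (hsq r).fun_mul (hsq r')
  simp only [energy_rescale]
  have hderiv := ((HasDerivAt.fun_sum fun i (_ : i ∈ Finset.univ) =>
    (hsq (ρ i)).mul_const (normSq (V i) (u i))).const_mul (1 / 2)).sub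
    ((HasDerivAt.fun_sum fun i (_ : i ∈ Finset.univ) =>
      HasDerivAt.fun_sum fun j (_ : j ∈ Finset.univ) =>
        (hsq_mul (ρ i) (ρ j)).mul_const (coupling (B i j) (u i) (u j))).const_mul (1 / 4))
  refine hderiv.congr_deriv ?_
  have hswap : ∑ i, ∑ j, ρ j * coupling (B i j) (u i) (u j) =
      ∑ i, ρ i * ∑ j, coupling (B i j) (u i) (u j) := by
    rw [Finset.sum_comm]
    refine Finset.sum_congr rfl fun i _ => ?_
    rw [Finset.mul_sum]
    exact Finset.sum_congr rfl fun j _ => by rw [hB j i, coupling_comm]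
  simp only [add_mul, mul_sub, Finset.sum_add_distrib, Finset.sum_sub_distrib, mul_assoc,
    ← Finset.mul_sum, hswap]
  ring

lemma partialDeriv_energy_self (V : Fin d → LInf Ω) {B : Fin d → Fin d → LInf Ω}
    (hB : ∀ i j, B i j = B j i) (u : HProd Ω d) (i : Fin d) :
    partialDeriv (energy V B) u i (u i) =
      normSq (V i) (u i) - ∑ j, coupling (B i j) (u i) (u j) := by
  simp only [partialDeriv, lineDeriv, add_smul_single_eq_rescale]
  rw [(hasDerivAt_energy_rescale V hB u _).deriv]
  simp

end Rescaling

section Nehari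

variable {N : ℕ} {Ω : Set (Eucl N)} {d m : ℕ} {a : Fin (m + 1) → ℕ}
  {V : Fin d → LInf Ω} {B : Fin d → Fin d → LInf Ω} {u : HProd Ω d}

/-- The quadratic part `∑_{i ∈ I_h} ‖u_i‖_{V_i}²` of the energy of the group `I_h`. -/
def groupNormSq (a : Fin (m + 1) → ℕ) (V : Fin d → LInf Ω) (u : HProd Ω d) (h : Fin m) : ℝ :=
  ∑ i ∈ group d a h, normSq (V i) (u i)

/-- The interaction `∑_{i, j ∈ I_h} ∫ β_ij u_i² u_j²` within the group `I_h`. -/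
def groupCoupling (a : Fin (m + 1) → ℕ) (B : Fin d → Fin d → LInf Ω) (u : HProd Ω d)
    (h : Fin m) : ℝ :=
  ∑ i ∈ group d a h, ∑ j ∈ group d a h, coupling (B i j) (u i) (u j)

/-- Components of different groups are segregated. -/
def IsSegregated (a : Fin (m + 1) → ℕ) (u : HProd Ω d) : Prop :=
  ∀ i j, (i, j) ∈ K2 d a → overlap (u i) (u j) = 0

open Classical in
/-- The coupling matrix `B` with the interaction between different groups switched off; its energy
is the limit energy. -/
def decoupled (a : Fin (m + 1) → ℕ) (B : Fin d → Fin d → LInf Ω) (i j : Fin d) : LInf Ω :=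
  if (i, j) ∈ K2 d a then 0 else B i j

lemma K2_swap {i j : Fin d} : (i, j) ∈ K2 d a ↔ (j, i) ∈ K2 d a :=
  ⟨fun ⟨h, k, hne, hi, hj⟩ => ⟨k, h, hne.symm, hj, hi⟩,
    fun ⟨h, k, hne, hi, hj⟩ => ⟨k, h, hne.symm, hj, hi⟩⟩

lemma decoupled_comm (hB : ∀ i j, B i j = B j i) (i j : Fin d) :
    decoupled a B i j = decoupled a B j i := by
  rw [decoupled, decoupled, hB i j, K2_swap]

lemma coupling_decoupled_eq_zero {i j : Fin d} (hij : (i, j) ∈ K2 d a) (v w : H01 Ω) :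
    coupling (decoupled a B i j) v w = 0 := by
  rw [decoupled, if_pos hij, coupling_zero_left]

lemma mem_nehari_energy_iff (hB : ∀ i j, B i j = B j i) :
    u ∈ nehari a V (energy V B) ↔ ∀ h, groupNormSq a V u h ≠ 0 ∧
      groupNormSq a V u h = ∑ i ∈ group d a h, ∑ j, coupling (B i j) (u i) (u j) := by
  simp only [nehari, Set.mem_ofPred_eq, partialDeriv_energy_self V hB, Finset.sum_sub_distrib,
    sub_eq_zero, groupNormSq]

namespace IsDecomposition

variable (ha : IsDecomposition m d a)
include ha

lemma mem_K2_iff_notMem {h : Fin m} {i j : Fin d} (hi : i ∈ group d a h) :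
    (i, j) ∈ K2 d a ↔ j ∉ group d a h := by
  rw [ha.mem_K2_iff, ha.mem_group_iff, ha.mem_group_iff.1 hi, ne_comm]

lemma sum_eq_sum_group {f : Fin d → ℝ} {h : Fin m} {i : Fin d} (hi : i ∈ group d a h)
    (hf : ∀ j, (i, j) ∈ K2 d a → f j = 0) : ∑ j, f j = ∑ j ∈ group d a h, f j :=
  (Finset.sum_subset (Finset.subset_univ _) fun j _ hj =>
    hf j ((ha.mem_K2_iff_notMem hi).2 hj)).symm

lemma sum_coupling_decoupled (B : Fin d → Fin d → LInf Ω) (u : HProd Ω d) (h : Fin m) :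
    ∑ i ∈ group d a h, ∑ j, coupling (decoupled a B i j) (u i) (u j) = groupCoupling a B u h := by
  refine Finset.sum_congr rfl fun i hi => ?_
  rw [ha.sum_eq_sum_group hi fun j hij => coupling_decoupled_eq_zero hij _ _]
  refine Finset.sum_congr rfl fun j hj => ?_
  rw [decoupled, if_neg (mt (ha.mem_K2_iff_notMem hi).1 (not_not.2 hj))]

lemma limitEnergy_eq_energy (V : Fin d → LInf Ω) (B : Fin d → Fin d → LInf Ω) :
    limitEnergy a V B = energy V (decoupled a B) := by
  funext u
  rw [energy, ← ha.sum_group fun i => ∑ j, coupling (decoupled a B i j) (u i) (u j)]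
  simp_rw [ha.sum_coupling_decoupled]
  rfl

lemma mem_limitSet_iff (hB : ∀ i j, B i j = B j i) : u ∈ limitSet a V B ↔
    (∀ h, groupNormSq a V u h ≠ 0 ∧ groupNormSq a V u h = groupCoupling a B u h) ∧
      IsSegregated a u := by
  rw [limitSet, ha.limitEnergy_eq_energy, Set.mem_ofPred_eq,
    mem_nehari_energy_iff (decoupled_comm hB)]
  simp only [ha.sum_coupling_decoupled, IsSegregated, overlap]

lemma energy_eq_of_mem_nehari (hB : ∀ i j, B i j = B j i) (hu : u ∈ nehari a V (energy V B)) :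
    energy V B u = (1 / 4) * ∑ h, groupNormSq a V u h := by
  have hquartic : ∑ h, groupNormSq a V u h = ∑ i, ∑ j, coupling (B i j) (u i) (u j) := by
    rw [← ha.sum_group]
    exact Finset.sum_congr rfl fun h _ => ((mem_nehari_energy_iff hB).1 hu h).2
  have hquadratic : ∑ h, groupNormSq a V u h = ∑ i, normSq (V i) (u i) := ha.sum_group _
  rw [energy, ← hquartic, ← hquadratic]
  ring

lemma limitEnergy_eq_of_mem_limitSet (hB : ∀ i j, B i j = B j i) (hu : u ∈ limitSet a V B) :
    limitEnergy a V B u = (1 / 4) * ∑ h, groupNormSq a V u h := by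
  have hu' := hu.1
  rw [ha.limitEnergy_eq_energy] at hu' ⊢
  exact ha.energy_eq_of_mem_nehari (decoupled_comm hB) hu'

lemma groupNormSq_rescale (V : Fin d → LInf Ω) (t : Fin m → ℝ) (u : HProd Ω d) (h : Fin m) :
    groupNormSq a V (rescale (t ∘ ha.index) u) h = t h ^ 2 * groupNormSq a V u h := by
  rw [groupNormSq, groupNormSq, Finset.mul_sum]
  refine Finset.sum_congr rfl fun i hi => ?_
  rw [rescale_apply, normSq_smul, Function.comp_apply, ha.mem_group_iff.1 hi]

lemma groupCoupling_rescale (B : Fin d → Fin d → LInf Ω) (t : Fin m → ℝ) (u : HProd Ω d)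
    (h : Fin m) : groupCoupling a B (rescale (t ∘ ha.index) u) h =
      t h ^ 2 * t h ^ 2 * groupCoupling a B u h := by
  simp_rw [groupCoupling, Finset.mul_sum]
  refine Finset.sum_congr rfl fun i hi => Finset.sum_congr rfl fun j hj => ?_
  rw [rescale_apply, rescale_apply, coupling_smul, Function.comp_apply, Function.comp_apply,
    ha.mem_group_iff.1 hi, ha.mem_group_iff.1 hj]

lemma exists_mem_limitSet (hB : ∀ i j, B i j = B j i) (hu : IsSegregated a u)
    (hq : ∀ h, 0 < groupNormSq a V u h) (hD : ∀ h, 0 < groupCoupling a B u h) :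
    ∃ w ∈ limitSet a V B, ∑ h, groupNormSq a V w h =
      ∑ h, groupNormSq a V u h ^ 2 / groupCoupling a B u h := by
  -- The group `I_h` is rescaled by the maximum point of `t ↦ t² q_h / 2 - t⁴ D_h / 4`.
  let t (h : Fin m) : ℝ := √(groupNormSq a V u h / groupCoupling a B u h)
  have ht (h : Fin m) : t h ^ 2 = groupNormSq a V u h / groupCoupling a B u h :=
    Real.sq_sqrt (div_pos (hq h) (hD h)).le
  refine ⟨rescale (t ∘ ha.index) u,
    (ha.mem_limitSet_iff hB).2 ⟨fun h => ⟨?_, ?_⟩, fun i j hij => ?_⟩,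
    Finset.sum_congr rfl fun h _ => ?_⟩
  · rw [groupNormSq_rescale, ht]
    exact (mul_pos (div_pos (hq h) (hD h)) (hq h)).ne'
  · rw [groupNormSq_rescale, groupCoupling_rescale, ht]
    have := (hD h).ne'
    field_simp
  · rw [rescale_apply, rescale_apply, overlap_smul, hu i j hij, mul_zero]
  · rw [groupNormSq_rescale, ht]
    ring

variable {T : H01 Ω →L[ℝ] Lp ℝ 4 (vol Ω)} (hT : IsL4Embedding T)
include hT

lemma limitSet_subset_nehari (hB : ∀ i j, B i j = B j i) :
    limitSet a V B ⊆ nehari a V (energy V B) := fun w hw => by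
  obtain ⟨hnehari, hseg⟩ := (ha.mem_limitSet_iff hB).1 hw
  refine (mem_nehari_energy_iff hB).2 fun h => ⟨(hnehari h).1, (hnehari h).2.trans ?_⟩
  exact Finset.sum_congr rfl fun i hi =>
    (ha.sum_eq_sum_group hi fun j hij => hT.coupling_eq_zero _ (hseg i j hij)).symm

lemma sum_groupNormSq_le_of_isMinOn (hB : ∀ i j, B i j = B j i) {v w : HProd Ω d}
    (hv : v ∈ nehari a V (energy V B)) (hmin : IsMinOn (energy V B) (nehari a V (energy V B)) v)
    (hw : w ∈ limitSet a V B) : ∑ h, groupNormSq a V v h ≤ ∑ h, groupNormSq a V w h := by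
  have hwn := ha.limitSet_subset_nehari hT hB hw
  have hle := isMinOn_iff.1 hmin w hwn
  rw [ha.energy_eq_of_mem_nehari hB hv, ha.energy_eq_of_mem_nehari hB hwn] at hle
  linarith

end IsDecomposition

end Nehari

/-! ### A priori estimates -/

section Competition

variable {N : ℕ} {Ω : Set (Eucl N)} {d m : ℕ} {a : Fin (m + 1) → ℕ}
  {V : Fin d → LInf Ω} {B : Fin d → Fin d → LInf Ω} {u : HProd Ω d}

/-- Components of different groups repel each other. -/
def IsCompetitive (a : Fin (m + 1) → ℕ) (B : Fin d → Fin d → LInf Ω) : Prop :=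
  ∀ i j, (i, j) ∈ K2 d a → ∀ᵐ x ∂(vol Ω), B i j x ≤ 0

lemma negCoupling_le_interGroup (B : Fin d → Fin d → LInf Ω) (u : HProd Ω d) {i j : Fin d}
    (hij : (i, j) ∈ K2 d a) : negCoupling (B i j) (u i) (u j) ≤ interGroup a B u := by
  classical
  exact Finset.single_le_sum (f := fun p : Fin d × Fin d => negCoupling (B p.1 p.2) (u p.1) (u p.2))
    (fun _ _ => negCoupling_nonneg _ _ _) (Finset.mem_filter.2 ⟨Finset.mem_univ (i, j), hij⟩)

lemma Admissible.ae_nonneg (hadm : Admissible a V B) {h : Fin m} {i j : Fin d}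
    (hi : i ∈ group d a h) (hj : j ∈ group d a h) : ∀ᵐ x ∂(vol Ω), 0 ≤ B i j x := by
  rcases eq_or_ne i j with rfl | hij
  · obtain ⟨μ, hμ, hB⟩ := hadm.2.2.1 i
    exact hB.mono fun x hx => hμ.le.trans hx
  · exact hadm.2.2.2 i j ⟨hij, h, hi, hj⟩

lemma IsDecomposition.interGroup_eq (ha : IsDecomposition m d a) (B : Fin d → Fin d → LInf Ω)
    (u : HProd Ω d) : interGroup a B u = ∑ h, ∑ i ∈ group d a h, ∑ j ∈ (group d a h)ᶜ,
      negCoupling (B i j) (u i) (u j) := by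
  classical
  rw [interGroup, Finset.sum_filter, Fintype.sum_prod_type, ← ha.sum_group]
  refine Finset.sum_congr rfl fun h _ => Finset.sum_congr rfl fun i hi => ?_
  rw [← Finset.sum_filter]
  refine Finset.sum_congr ?_ fun _ _ => rfl
  ext j
  simp [ha.mem_K2_iff_notMem hi]

lemma Admissible.sum_negCoupling (hadm : Admissible a V B) (ha : IsDecomposition m d a)
    (u : HProd Ω d) : ∑ i, ∑ j, negCoupling (B i j) (u i) (u j) = interGroup a B u := by
  rw [ha.interGroup_eq, ← ha.sum_group]
  refine Finset.sum_congr rfl fun h _ => Finset.sum_congr rfl fun i hi => ?_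
  rw [← Finset.sum_add_sum_compl (group d a h), add_eq_right]
  exact Finset.sum_eq_zero fun j hj => negCoupling_eq_zero_of_nonneg (hadm.ae_nonneg hi hj) _ _

namespace IsCompetitive

variable (hcomp : IsCompetitive a B) (ha : IsDecomposition m d a) (hB : ∀ i j, B i j = B j i)
  (hu : u ∈ nehari a V (energy V B))
include hcomp ha hB hu

lemma groupNormSq_eq_sub (h : Fin m) : groupNormSq a V u h = groupCoupling a B u h -
    ∑ i ∈ group d a h, ∑ j ∈ (group d a h)ᶜ, negCoupling (B i j) (u i) (u j) := by
  rw [((mem_nehari_energy_iff hB).1 hu h).2, groupCoupling, ← Finset.sum_sub_distrib]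
  refine Finset.sum_congr rfl fun i hi => ?_
  rw [← Finset.sum_add_sum_compl (group d a h), sub_eq_add_neg, ← Finset.sum_neg_distrib]
  congr 1
  refine Finset.sum_congr rfl fun j hj => ?_
  have hij := (ha.mem_K2_iff_notMem hi).2 (Finset.mem_compl.1 hj)
  rw [negCoupling_eq_neg_coupling (hcomp i j hij), neg_neg]

lemma groupNormSq_le_groupCoupling (h : Fin m) : groupNormSq a V u h ≤ groupCoupling a B u h := by
  rw [hcomp.groupNormSq_eq_sub ha hB hu]
  exact sub_le_self _ <| Finset.sum_nonneg fun i _ => Finset.sum_nonneg fun j _ =>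
    negCoupling_nonneg _ _ _

lemma interGroup_eq_sub :
    interGroup a B u = ∑ h, groupCoupling a B u h - ∑ h, groupNormSq a V u h := by
  rw [ha.interGroup_eq, ← Finset.sum_sub_distrib]
  refine Finset.sum_congr rfl fun h _ => ?_
  rw [hcomp.groupNormSq_eq_sub ha hB hu, sub_sub_cancel]

end IsCompetitive

end Competition

section Bounds

variable {N : ℕ} {Ω : Set (Eucl N)} {d m : ℕ} {a : Fin (m + 1) → ℕ}
  {V : Fin d → LInf Ω} {B : Fin d → Fin d → LInf Ω} {c : ℝ} {h : Fin m}

namespace IsCoercive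

variable (hV : IsCoercive c V)
include hV

lemma mul_sum_norm_sq_le_groupNormSq (u : HProd Ω d) (h : Fin m) :
    c * ∑ i ∈ group d a h, ‖u i‖ ^ 2 ≤ groupNormSq a V u h := by
  rw [Finset.mul_sum]
  exact Finset.sum_le_sum fun i _ => hV i (u i)

lemma mul_sum_norm_sq_le (ha : IsDecomposition m d a) (u : HProd Ω d) :
    c * ∑ i, ‖u i‖ ^ 2 ≤ ∑ h, groupNormSq a V u h := by
  rw [← ha.sum_group, Finset.mul_sum]
  exact Finset.sum_le_sum fun h _ => hV.mul_sum_norm_sq_le_groupNormSq u h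

lemma groupNormSq_nonneg (hc : 0 < c) (u : HProd Ω d) (h : Fin m) : 0 ≤ groupNormSq a V u h :=
  le_trans (by positivity) (hV.mul_sum_norm_sq_le_groupNormSq u h)

lemma groupNormSq_pos (hc : 0 < c) {u : HProd Ω d} {i : Fin d} (hi : i ∈ group d a h)
    (hui : u i ≠ 0) : 0 < groupNormSq a V u h := by
  refine lt_of_lt_of_le (mul_pos hc ?_) (hV.mul_sum_norm_sq_le_groupNormSq u h)
  exact Finset.sum_pos' (fun _ _ => sq_nonneg _) ⟨i, hi, by positivity⟩

end IsCoercive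

variable {T : H01 Ω →L[ℝ] Lp ℝ 4 (vol Ω)} (hT : IsL4Embedding T)
include hT

lemma Admissible.groupCoupling_pos (hadm : Admissible a V B) {u : HProd Ω d} {i : Fin d}
    (hi : i ∈ group d a h) (hui : T (u i) ≠ 0) : 0 < groupCoupling a B u h := by
  have hnonneg : ∀ k ∈ group d a h, ∀ l ∈ group d a h, 0 ≤ coupling (B k l) (u k) (u l) :=
    fun k hk l hl => coupling_nonneg (hadm.ae_nonneg hk hl) _ _
  obtain ⟨μ, hμ, hB⟩ := hadm.2.2.1 i
  have hself : 0 < coupling (B i i) (u i) (u i) :=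
    (mul_pos hμ (hT.overlap_self_pos hui)).trans_le (hT.mul_overlap_le_coupling hB _ _)
  exact Finset.sum_pos' (fun k hk => Finset.sum_nonneg (hnonneg k hk))
    ⟨i, hi, Finset.sum_pos' (hnonneg i hi) ⟨i, hi, hself⟩⟩

lemma IsL4Embedding.groupCoupling_le {b : ℝ}
    (hb : ∀ i ∈ group d a h, ∀ j ∈ group d a h, ‖B i j‖ ≤ b) (u : HProd Ω d) :
    groupCoupling a B u h ≤ b * (∑ i ∈ group d a h, ‖T (u i)‖ ^ 2) ^ 2 := by
  simp_rw [sq (∑ _ ∈ group d a h, _), Finset.sum_mul_sum, Finset.mul_sum]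
  refine Finset.sum_le_sum fun i hi => Finset.sum_le_sum fun j hj => ?_
  refine (hT.coupling_le _ _ _).trans ?_
  rw [mul_assoc]
  gcongr
  exact hb i hi j hj

end Bounds

section APrioriEstimates

variable {N : ℕ} {Ω : Set (Eucl N)} {d m : ℕ} {a : Fin (m + 1) → ℕ}
  {V : Fin d → LInf Ω} {B : Fin d → Fin d → LInf Ω} {u : HProd Ω d}
  {T : H01 Ω →L[ℝ] Lp ℝ 4 (vol Ω)} {c b κ : ℝ}

lemma sum_integral_norm_grad_sq_le (u : HProd Ω d) :
    ∑ i, ∫ x, ‖grad (u i) x‖ ^ 2 ∂(vol Ω) ≤ ∑ i, ‖u i‖ ^ 2 :=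
  Finset.sum_le_sum fun i _ => by
    rw [← norm_sq_gradL2]
    gcongr
    exact norm_gradL2_le _

lemma mul_sum_norm_L4_sq_le (hV : IsCoercive c V) (hc : 0 < c) (hκ₀ : 0 ≤ κ)
    (hκ : ∀ v, ‖T v‖ ^ 2 ≤ κ * ‖v‖ ^ 2) (u : HProd Ω d) (h : Fin m) :
    c * ∑ i ∈ group d a h, ‖T (u i)‖ ^ 2 ≤ κ * groupNormSq a V u h :=
  calc c * ∑ i ∈ group d a h, ‖T (u i)‖ ^ 2
      ≤ c * ∑ i ∈ group d a h, κ * ‖u i‖ ^ 2 := by gcongr; exact hκ _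
    _ = κ * (c * ∑ i ∈ group d a h, ‖u i‖ ^ 2) := by rw [← Finset.mul_sum]; ring
    _ ≤ κ * groupNormSq a V u h := by gcongr; exact hV.mul_sum_norm_sq_le_groupNormSq u h

variable (ha : IsDecomposition m d a) (hT : IsL4Embedding T) (hcomp : IsCompetitive a B)
  (hu : u ∈ nehari a V (energy V B)) (hV : IsCoercive c V) (hc : 0 < c) (hκ₀ : 0 < κ)
  (hκ : ∀ v, ‖T v‖ ^ 2 ≤ κ * ‖v‖ ^ 2) (hb₀ : 0 < b)
  (hb : ∀ h, ∀ i ∈ group d a h, ∀ j ∈ group d a h, ‖B i j‖ ≤ b)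
include ha hT hcomp hu hV hc hκ₀ hκ hb₀ hb

lemma div_le_sum_norm_L4_sq_of_mem_nehari (hB : ∀ i j, B i j = B j i) (h : Fin m) :
    c / (κ * b) ≤ ∑ i ∈ group d a h, ‖T (u i)‖ ^ 2 := by
  set X := ∑ i ∈ group d a h, ‖T (u i)‖ ^ 2
  have hX₀ : 0 ≤ X := Finset.sum_nonneg fun i _ => sq_nonneg _
  have hqX : groupNormSq a V u h ≤ b * X ^ 2 :=
    (hcomp.groupNormSq_le_groupCoupling ha hB hu h).trans (hT.groupCoupling_le (hb h) u)
  have hX : 0 < X := by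
    refine hX₀.lt_of_ne fun hX => ((mem_nehari_energy_iff hB).1 hu h).1 <|
      le_antisymm ?_ (hV.groupNormSq_nonneg hc u h)
    simpa [← hX] using hqX
  have hcX : c * X ≤ (κ * b * X) * X :=
    calc c * X ≤ κ * groupNormSq a V u h := mul_sum_norm_L4_sq_le hV hc hκ₀.le hκ u h
      _ ≤ κ * (b * X ^ 2) := by gcongr
      _ = (κ * b * X) * X := by ring
  rw [div_le_iff₀' (by positivity)]
  exact le_of_mul_le_mul_right hcX hX

lemma interGroup_le_of_mem_nehari (hB : ∀ i j, B i j = B j i) {R : ℝ}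
    (hR : ∑ i, ‖u i‖ ^ 2 ≤ R) :
    interGroup a B u ≤ b * (κ * R) ^ 2 := by
  have hX : ∑ h, ∑ i ∈ group d a h, ‖T (u i)‖ ^ 2 ≤ κ * R :=
    calc ∑ h, ∑ i ∈ group d a h, ‖T (u i)‖ ^ 2
        = ∑ i, ‖T (u i)‖ ^ 2 := ha.sum_group _
      _ ≤ κ * ∑ i, ‖u i‖ ^ 2 := by
          rw [Finset.mul_sum]
          exact Finset.sum_le_sum fun i _ => hκ _
      _ ≤ κ * R := by gcongr
  calc interGroup a B u
      ≤ ∑ h, groupCoupling a B u h := by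
        rw [hcomp.interGroup_eq_sub ha hB hu]
        exact sub_le_self _ (Finset.sum_nonneg fun h _ => hV.groupNormSq_nonneg hc u h)
    _ ≤ ∑ h, b * (∑ i ∈ group d a h, ‖T (u i)‖ ^ 2) ^ 2 :=
        Finset.sum_le_sum fun h _ => hT.groupCoupling_le (hb h) u
    _ ≤ b * (∑ h, ∑ i ∈ group d a h, ‖T (u i)‖ ^ 2) ^ 2 := by
        rw [← Finset.mul_sum]
        gcongr
        exact Finset.sum_sq_le_sq_sum_of_nonneg fun h _ => Finset.sum_nonneg fun i _ => sq_nonneg _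
    _ ≤ b * (κ * R) ^ 2 := by gcongr

theorem estimates_of_mem_nehari (hadm : Admissible a V B) {E : ℝ}
    (hE : ∑ h, groupNormSq a V u h ≤ E) :
    Estimates a B (E / c) (c / (κ * b)) (b * (κ * (E / c)) ^ 2) u := by
  have hR : ∑ i, ‖u i‖ ^ 2 ≤ E / c := by
    rw [le_div_iff₀' hc]
    exact (hV.mul_sum_norm_sq_le ha u).trans hE
  refine ⟨(sum_integral_norm_grad_sq_le u).trans hR, fun h => ?_, ?_⟩
  · simp_rw [← hT.norm_eq]
    exact div_le_sum_norm_L4_sq_of_mem_nehari ha hT hcomp hu hV hc hκ₀ hκ hb₀ hb hadm.1 h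
  · rw [hadm.sum_negCoupling ha]
    exact interGroup_le_of_mem_nehari ha hT hcomp hu hV hc hκ₀ hκ hb₀ hb hadm.1 hR

end APrioriEstimates

/-! ### Segregated competitors -/

section Competitor

lemma exists_seq_isOpen_subset_pairwise_disjoint {X : Type*} [TopologicalSpace X] [T2Space X]
    {s : Set X} (hs : IsOpen s) (hinf : s.Infinite) : ∃ U : ℕ → Set X, (∀ n, (U n).Nonempty) ∧
      (∀ n, IsOpen (U n)) ∧ (∀ n, U n ⊆ s) ∧ Pairwise (Function.onFun Disjoint U) := by
  have : Infinite s := hinf.to_subtype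
  obtain ⟨U, hUinf, hU, hdisj⟩ := exists_seq_infinite_isOpen_pairwise_disjoint s
  exact ⟨fun n => Subtype.val '' U n, fun n => (hUinf n).nonempty.image _,
    fun n => hs.isOpenMap_subtype_val _ (hU n), fun n => Subtype.coe_image_subset _ _,
    fun n k hnk => (disjoint_image_iff Subtype.val_injective).2 (hdisj hnk)⟩

variable {N : ℕ} {Ω : Set (Eucl N)}

lemma exists_val_ae_eq {φ : Eucl N → ℝ} (hφ : ContDiff ℝ ∞ φ) (hc : HasCompactSupport φ)
    (hsupp : tsupport φ ⊆ Ω) : ∃ u : H01 Ω, val u =ᵐ[vol Ω] φ := by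
  have hφ2 : MemLp φ 2 (vol Ω) := hφ.continuous.memLp_of_hasCompactSupport hc
  have hgrad : MemLp (∇ φ) 2 (vol Ω) := by
    have hcont : Continuous (∇ φ) :=
      (InnerProductSpace.toDual ℝ (Eucl N)).symm.continuous.comp (hφ.continuous_fderiv (by simp))
    refine hcont.memLp_of_hasCompactSupport ((hc.fderiv ℝ).mono fun x hx h => hx ?_)
    simp [gradient, h]
  exact ⟨⟨_, (testPairs Ω).le_topologicalClosure (x := WithLp.toLp 2 (hφ2.toLp, hgrad.toLp))
    ⟨φ, hφ, hc, hsupp, hφ2.coeFn_toLp, hgrad.coeFn_toLp⟩⟩, hφ2.coeFn_toLp⟩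

lemma exists_val_ne_zero_ae_eq_zero_compl {U : Set (Eucl N)} (hU : IsOpen U) (hne : U.Nonempty)
    (hUΩ : U ⊆ Ω) :
    ∃ u : H01 Ω, ¬ val u =ᵐ[vol Ω] 0 ∧ ∀ᵐ x ∂(vol Ω), x ∉ U → val u x = 0 := by
  obtain ⟨p, hp⟩ := hne
  obtain ⟨φ, hsupp, hc, hφ, -, hφp⟩ :=
    exists_contDiff_tsupport_subset (n := (⊤ : ℕ∞)) (hU.mem_nhds hp)
  obtain ⟨u, hu⟩ := exists_val_ae_eq hφ hc (hsupp.trans hUΩ)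
  refine ⟨u, ?_, ?_⟩
  · intro hzero
    have hae : φ =ᵐ[vol U] 0 :=
      ae_restrict_of_ae_restrict_of_subset hUΩ (hu.symm.trans hzero)
    have heq := Measure.eqOn_open_of_ae_eq hae hU hφ.continuous.continuousOn continuousOn_const hp
    simp [hφp] at heq
  · filter_upwards [hu] with x hx hxU
    rw [hx]
    exact image_eq_zero_of_notMem_tsupport fun h => hxU (hsupp h)

variable {d m : ℕ} {a : Fin (m + 1) → ℕ}

lemma IsDecomposition.exists_isSegregated (ha : IsDecomposition m d a) (hN : 1 ≤ N)
    (hΩ : IsOpen Ω) (hne : Ω.Nonempty) :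
    ∃ w : HProd Ω d, IsSegregated a w ∧ ∀ i, ¬ val (w i) =ᵐ[vol Ω] 0 := by
  have : Nonempty (Fin N) := ⟨⟨0, hN⟩⟩
  have hinf : Ω.Infinite := hne.elim fun x hx => infinite_of_mem_nhds x (hΩ.mem_nhds hx)
  obtain ⟨U, hUne, hU, hUΩ, hdisj⟩ := exists_seq_isOpen_subset_pairwise_disjoint hΩ hinf
  choose v hv hvU using fun n =>
    exists_val_ne_zero_ae_eq_zero_compl (hU n) (hUne n) (hUΩ n)
  refine ⟨WithLp.toLp 2 fun i => v (ha.index i), fun i j hij => integral_eq_zero_of_ae ?_,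
    fun i => hv _⟩
  have hne : (ha.index i : ℕ) ≠ ha.index j := Fin.val_ne_of_ne (ha.mem_K2_iff.1 hij)
  filter_upwards [hvU (ha.index i), hvU (ha.index j)] with x hi hj
  by_cases hx : x ∈ U (ha.index i)
  · simp [hj fun hx' => disjoint_left.1 (hdisj hne) hx hx']
  · simp [hi hx]

lemma IsDecomposition.group_nonempty (ha : IsDecomposition m d a) (h : Fin m) :
    (group d a h).Nonempty := by
  have hlt : a h.castSucc < a h.succ := ha.2.1 Fin.castSucc_lt_succ
  have hle : a h.succ ≤ d := ha.2.2 ▸ ha.2.1.monotone (Fin.le_last _)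
  exact ⟨⟨a h.castSucc, by omega⟩, by simp [group, hlt]⟩

variable {T : H01 Ω →L[ℝ] Lp ℝ 4 (vol Ω)} {V V' : Fin d → LInf Ω} {B : Fin d → Fin d → LInf Ω}
  {c : ℝ}

-- If `Ω` is empty, then any Nehari-type set is empty or coincides with the whole space.
theorem limitSet_nonempty (hN : 1 ≤ N) (hΩ : IsOpen Ω) (ha : IsDecomposition m d a)
    (hT : IsL4Embedding T) (hadm : Admissible a V B) (hV : IsCoercive c V) (hc : 0 < c)
    {J : HProd Ω d → ℝ} (hJ : (nehari a V' J).Nonempty) : (limitSet a V B).Nonempty := by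
  rcases Ω.eq_empty_or_nonempty with rfl | hne
  · obtain ⟨u, hu⟩ := hJ
    exact ⟨u, fun h => absurd (by simp [normSq]) (hu h).1, fun i j _ => by simp⟩
  · obtain ⟨w, hseg, hw⟩ := ha.exists_isSegregated hN hΩ hne
    have hTw (i) : T (w i) ≠ 0 := hT.eq_zero_iff.not.2 (hw i)
    have hw₀ (i) : w i ≠ 0 := fun h => hTw i (by rw [h, map_zero])
    obtain ⟨w', hw', -⟩ := ha.exists_mem_limitSet (V := V) hadm.1 hseg
      (fun h => (ha.group_nonempty h).elim fun i hi => hV.groupNormSq_pos hc hi (hw₀ i))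
      (fun h => (ha.group_nonempty h).elim fun i hi => hadm.groupCoupling_pos hT hi (hTw i))
    exact ⟨w', hw'⟩

end Competitor

/-! ### Uniform estimates -/

section CompetingMinimizers

variable {N : ℕ} {Ω : Set (Eucl N)} {d m : ℕ}

/-- The functions `u n` minimize the energies with data `(V n, B n)` on their Nehari-type sets,
where along the filter `l` the potentials and the couplings within the groups converge to `V'` and
`B'`, while the couplings between different groups tend to `-∞`. -/
structure CompetingMinimizers {ι : Type*} (a : Fin (m + 1) → ℕ) (V : ι → Fin d → LInf Ω)
    (B : ι → Fin d → Fin d → LInf Ω) (u : ι → HProd Ω d) (l : Filter ι) (V' : Fin d → LInf Ω)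
    (B' : Fin d → Fin d → LInf Ω) : Prop where
  admissible : ∀ n, Admissible a (V n) (B n)
  competitive : ∀ n, IsCompetitive a (B n)
  tendsto_potential : ∀ i, Tendsto (fun n => V n i) l (𝓝 (V' i))
  tendsto_coupling : ∀ h, ∀ i ∈ group d a h, ∀ j ∈ group d a h,
    Tendsto (fun n => B n i j) l (𝓝 (B' i j))
  eventually_le : ∀ i j, (i, j) ∈ K2 d a → ∀ C : ℝ, ∀ᶠ n in l, ∀ᵐ x ∂(vol Ω), B n i j x ≤ C
  mem_nehari : ∀ n, u n ∈ nehari a (V n) (energy (V n) (B n))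
  isMinOn : ∀ n, IsMinOn (energy (V n) (B n)) (nehari a (V n) (energy (V n) (B n))) (u n)

variable {ι : Type*} {a : Fin (m + 1) → ℕ} {V : ι → Fin d → LInf Ω}
  {B : ι → Fin d → Fin d → LInf Ω} {u : ι → HProd Ω d} {l : Filter ι} {V' : Fin d → LInf Ω}
  {B' : Fin d → Fin d → LInf Ω} {T : H01 Ω →L[ℝ] Lp ℝ 4 (vol Ω)} {c : ℝ}

lemma tendsto_groupNormSq (hV : ∀ i, Tendsto (fun n => V n i) l (𝓝 (V' i))) {w : ι → HProd Ω d}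
    {w' : HProd Ω d} {e : Fin d → ℝ}
    (hL2 : ∀ i, Tendsto (fun n => toL2 Ω (w n i)) l (𝓝 (toL2 Ω (w' i))))
    (hnorm : ∀ i, Tendsto (fun n => ‖w n i‖ ^ 2) l (𝓝 (‖w' i‖ ^ 2 + e i))) (h : Fin m) :
    Tendsto (fun n => groupNormSq a (V n) (w n) h) l
      (𝓝 (groupNormSq a V' w' h + ∑ i ∈ group d a h, e i)) := by
  rw [groupNormSq, ← Finset.sum_add_distrib]
  exact tendsto_finsetSum _ fun i _ => tendsto_normSq (hV i) (hL2 i) (hnorm i)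

lemma sum_sq_div_groupCoupling_eq (ha : IsDecomposition m d a) (hB' : ∀ i j, B' i j = B' j i)
    {w : HProd Ω d} (hw : w ∈ limitSet a V' B') :
    ∑ h, groupNormSq a V' w h ^ 2 / groupCoupling a B' w h = ∑ h, groupNormSq a V' w h :=
  Finset.sum_congr rfl fun h _ => by
    obtain ⟨hne, heq⟩ := ((ha.mem_limitSet_iff hB').1 hw).1 h
    rw [← heq, sq, mul_div_cancel_right₀ _ hne]

namespace CompetingMinimizers

variable (H : CompetingMinimizers a V B u l V' B')
include H

lemma mono {l' : Filter ι} (hl : l' ≤ l) : CompetingMinimizers a V B u l' V' B' where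
  admissible := H.admissible
  competitive := H.competitive
  tendsto_potential i := (H.tendsto_potential i).mono_left hl
  tendsto_coupling h i hi j hj := (H.tendsto_coupling h i hi j hj).mono_left hl
  eventually_le i j hij C := hl (H.eventually_le i j hij C)
  mem_nehari := H.mem_nehari
  isMinOn := H.isMinOn

lemma tendsto_groupCoupling (hT : IsL4Embedding T) {w : ι → HProd Ω d} {w' : HProd Ω d}
    (hw : ∀ i, Tendsto (fun n => T (w n i)) l (𝓝 (T (w' i)))) (h : Fin m) :
    Tendsto (fun n => groupCoupling a (B n) (w n) h) l (𝓝 (groupCoupling a B' w' h)) :=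
  tendsto_finsetSum _ fun i hi => tendsto_finsetSum _ fun j hj =>
    hT.tendsto_coupling (H.tendsto_coupling h i hi j hj) (hw i) (hw j)

lemma eventually_isCoercive {c' : ℝ} (hV' : IsCoercive c V') (hc : c' < c) :
    ∀ᶠ n in l, IsCoercive c' (V n) := by
  have hclose : ∀ᶠ n in l, ∀ i, ‖V n i - V' i‖ < c - c' := eventually_all.2 fun i =>
    (tendsto_iff_norm_sub_tendsto_zero.1 (H.tendsto_potential i)).eventually_lt_const
      (sub_pos.2 hc)
  exact hclose.mono fun n hn => hV'.of_norm_sub_le fun i => (hn i).le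

lemma eventually_norm_coupling_le {b : ℝ} (hb : ∀ i j, ‖B' i j‖ < b) :
    ∀ᶠ n in l, ∀ h, ∀ i ∈ group d a h, ∀ j ∈ group d a h, ‖B n i j‖ ≤ b :=
  eventually_all.2 fun h => (eventually_all_finset _).2 fun i hi =>
    (eventually_all_finset _).2 fun j hj =>
      ((H.tendsto_coupling h i hi j hj).norm.eventually_lt_const (hb i j)).mono fun _ hn => hn.le

lemma eventually_sum_groupNormSq_lt (ha : IsDecomposition m d a) (hT : IsL4Embedding T)
    (hB' : ∀ i j, B' i j = B' j i) (hV' : IsCoercive c V') (hc : 0 < c) {w : HProd Ω d}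
    (hw : w ∈ limitSet a V' B') {E : ℝ} (hE : ∑ h, groupNormSq a V' w h < E) :
    ∀ᶠ n in l, ∑ h, groupNormSq a (V n) (u n) h < E := by
  obtain ⟨hnehari, hseg⟩ := (ha.mem_limitSet_iff hB').1 hw
  have hq (h) : 0 < groupNormSq a V' w h :=
    (hV'.groupNormSq_nonneg hc w h).lt_of_ne' (hnehari h).1
  have hD (h) : 0 < groupCoupling a B' w h := (hnehari h).2 ▸ hq h
  have hqn (h) : Tendsto (fun n => groupNormSq a (V n) w h) l (𝓝 (groupNormSq a V' w h)) := by
    simpa using tendsto_groupNormSq (a := a) (e := 0) H.tendsto_potential (w := fun _ => w)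
      (fun _ => tendsto_const_nhds) (by simp [tendsto_const_nhds]) h
  have hDn (h) : Tendsto (fun n => groupCoupling a (B n) w h) l (𝓝 (groupCoupling a B' w h)) :=
    H.tendsto_groupCoupling hT (fun _ => tendsto_const_nhds) h
  have hsum : Tendsto (fun n => ∑ h, groupNormSq a (V n) w h ^ 2 / groupCoupling a (B n) w h) l
      (𝓝 (∑ h, groupNormSq a V' w h)) := by
    rw [← sum_sq_div_groupCoupling_eq ha hB' hw]
    exact tendsto_finsetSum _ fun h _ => ((hqn h).pow 2).div (hDn h) (hD h).ne'
  filter_upwards [eventually_all.2 fun h => (hqn h).eventually_const_lt (hq h),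
    eventually_all.2 fun h => (hDn h).eventually_const_lt (hD h),
    hsum.eventually_lt_const hE] with n hqn hDn hlt
  obtain ⟨w', hw', hw'E⟩ := ha.exists_mem_limitSet (H.admissible n).1 hseg hqn hDn
  exact (ha.sum_groupNormSq_le_of_isMinOn hT (H.admissible n).1 (H.mem_nehari n) (H.isMinOn n)
    hw').trans_lt (hw'E.trans_lt hlt)

end CompetingMinimizers

theorem exists_uniform_estimates (hN : 1 ≤ N) (hN3 : N ≤ 3) (hΩ : IsOpen Ω)
    (hΩb : Bornology.IsBounded Ω) (ha : IsDecomposition m d a) (hadm : Admissible a V' B') :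
    ∃ γU γL M : ℝ, 0 < γU ∧ 0 < γL ∧ 0 < M ∧
      ∀ (V : ι → Fin d → LInf Ω) (B : ι → Fin d → Fin d → LInf Ω) (u : ι → HProd Ω d)
        (l : Filter ι), CompetingMinimizers a V B u l V' B' →
          ∀ᶠ n in l, Estimates a (B n) γU γL M (u n) := by
  obtain ⟨T, hT⟩ := exists_isL4Embedding hN hN3 hΩb
  obtain ⟨c, hc, hV'⟩ := hadm.exists_isCoercive hN hN3 hΩb
  rcases (limitSet a V' B').eq_empty_or_nonempty with hempty | ⟨w, hw⟩
  · refine ⟨1, 1, 1, one_pos, one_pos, one_pos, fun V B u l H => .of_forall fun n => ?_⟩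
    have := limitSet_nonempty hN hΩ ha hT hadm hV' hc ⟨u n, H.mem_nehari n⟩
    exact absurd hempty this.ne_empty
  set E := ∑ h, groupNormSq a V' w h + 1
  have hE : 0 < E :=
    add_pos_of_nonneg_of_pos (Finset.sum_nonneg fun h _ => hV'.groupNormSq_nonneg hc w h) one_pos
  set κ := ‖T‖ ^ 2 + 1
  have hκ (v) : ‖T v‖ ^ 2 ≤ κ * ‖v‖ ^ 2 :=
    calc ‖T v‖ ^ 2 ≤ (‖T‖ * ‖v‖) ^ 2 := by gcongr; exact T.le_opNorm v
      _ ≤ κ * ‖v‖ ^ 2 := by rw [mul_pow]; gcongr; exact (lt_add_one _).le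
  obtain ⟨b, hb₀, hb⟩ : ∃ b : ℝ, 0 < b ∧ ∀ i j, ‖B' i j‖ < b := by
    obtain ⟨b, hb⟩ := Finite.exists_le fun p : Fin d × Fin d => ‖B' p.1 p.2‖
    exact ⟨|b| + 1, by positivity, fun i j =>
      ((hb (i, j)).trans (le_abs_self b)).trans_lt (lt_add_one _)⟩
  refine ⟨E / (c / 2), c / 2 / (κ * b), b * (κ * (E / (c / 2))) ^ 2, by positivity,
    by positivity, by positivity, fun V B u l H => ?_⟩
  filter_upwards [H.eventually_isCoercive hV' (half_lt_self hc), H.eventually_norm_coupling_le hb,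
    H.eventually_sum_groupNormSq_lt ha hT hadm.1 hV' hc hw (lt_add_one _)] with n hVn hbn hEn
  exact estimates_of_mem_nehari ha hT (H.competitive n) (H.mem_nehari n) hVn (half_pos hc)
    (by positivity) hκ hb₀ hbn (H.admissible n) hEn.le

end CompetingMinimizers

/-! ### Compactness of minimizers -/

section WeakLimits

variable {H : Type*} [NormedAddCommGroup H] [InnerProductSpace ℝ H] {ι : Type*}

lemma exists_weaklyTendsto [CompleteSpace H] (l : Ultrafilter ι) {w : ι → H} {R : ℝ}
    (hR : ∀ᶠ n in l, ‖w n‖ ≤ R) : ∃ u, WeaklyTendsto w l u := by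
  let D (n : ι) : WeakDual ℝ H := StrongDual.toWeakDual (InnerProductSpace.toDual ℝ H (w n))
  obtain ⟨F, -, hF⟩ := (WeakDual.isCompact_closedBall (𝕜 := ℝ) (0 : StrongDual ℝ H) R)
    |>.ultrafilter_le_nhds (l.map D) (by
      rw [Ultrafilter.coe_map, le_principal_iff, mem_map]
      filter_upwards [hR] with n hn
      simpa [D] using hn)
  refine ⟨(InnerProductSpace.toDual ℝ H).symm (WeakDual.toStrongDual F), fun f => ?_⟩
  have hf (v : H) : f v = inner ℝ v ((InnerProductSpace.toDual ℝ H).symm f) := by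
    rw [real_inner_comm, InnerProductSpace.toDual_symm_apply]
  simp only [hf, InnerProductSpace.toDual_symm_apply]
  exact ((WeakDual.eval_continuous _).tendsto F).comp hF

/-- Weak convergence of `w` to `u` along `l`, where passing to the limit loses the amount `e` of the
squared norm. -/
structure WeaklyTendstoWithDefect (w : ι → H) (l : Filter ι) (u : H) (e : ℝ) : Prop where
  weaklyTendsto : WeaklyTendsto w l u
  tendsto_norm_sq : Tendsto (fun n => ‖w n‖ ^ 2) l (𝓝 (‖u‖ ^ 2 + e))

lemma exists_weaklyTendstoWithDefect [CompleteSpace H] (l : Ultrafilter ι) {w : ι → H} {R : ℝ}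
    (hR : ∀ᶠ n in l, ‖w n‖ ≤ R) : ∃ u e, WeaklyTendstoWithDefect w l u e := by
  obtain ⟨u, hu⟩ := exists_weaklyTendsto l hR
  obtain ⟨r, -, hr⟩ := (isCompact_Icc (a := 0) (b := R ^ 2)).ultrafilter_le_nhds
    (l.map fun n => ‖w n‖ ^ 2) (by
      rw [Ultrafilter.coe_map, le_principal_iff, mem_map]
      filter_upwards [hR] with n hn
      exact ⟨sq_nonneg _, pow_le_pow_left₀ (norm_nonneg _) hn 2⟩)
  exact ⟨u, r - ‖u‖ ^ 2, hu, by rwa [add_sub_cancel]⟩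

namespace WeaklyTendstoWithDefect

variable {l : Filter ι} {w : ι → H} {u : H} {e : ℝ}

lemma tendsto_norm_sub_sq (hw : WeaklyTendstoWithDefect w l u e) :
    Tendsto (fun n => ‖w n - u‖ ^ 2) l (𝓝 e) := by
  have hinner : Tendsto (fun n => inner ℝ (w n) u) l (𝓝 (inner ℝ u u)) := by
    simpa only [innerSL_apply_apply, real_inner_comm u] using hw.weaklyTendsto (innerSL ℝ u)
  simp only [norm_sub_sq_real]
  convert (hw.tendsto_norm_sq.sub (hinner.const_mul 2)).add_const (‖u‖ ^ 2) using 2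
  rw [real_inner_self_eq_norm_sq]
  ring

lemma nonneg [l.NeBot] (hw : WeaklyTendstoWithDefect w l u e) : 0 ≤ e :=
  ge_of_tendsto' hw.tendsto_norm_sub_sq fun _ => sq_nonneg _

lemma tendsto (hw : WeaklyTendstoWithDefect w l u 0) : Tendsto w l (𝓝 u) := by
  rw [tendsto_iff_norm_sub_tendsto_zero]
  simpa using hw.tendsto_norm_sub_sq.sqrt

end WeaklyTendstoWithDefect

lemma eq_of_sum_le_sum_sq_div [Fintype ι] {q A D : ι → ℝ} (hq : ∀ h, 0 < q h)
    (hqA : ∀ h, q h ≤ A h) (hAD : ∀ h, A h ≤ D h) (hsum : ∑ h, A h ≤ ∑ h, q h ^ 2 / D h) (h : ι) :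
    A h = q h ∧ D h = q h := by
  have hD (k) : 0 < D k := (hq k).trans_le ((hqA k).trans (hAD k))
  have hdiv (k) : q k ^ 2 / D k ≤ q k := by
    rw [div_le_iff₀ (hD k), sq]
    gcongr
    exacts [(hq k).le, (hqA k).trans (hAD k)]
  have hdiv_sum : ∑ k, q k ^ 2 / D k ≤ ∑ k, q k := Finset.sum_le_sum fun k _ => hdiv k
  have hA_sum : ∑ k, q k ≤ ∑ k, A k := Finset.sum_le_sum fun k _ => hqA k
  have hA := (Finset.sum_eq_sum_iff_of_le fun k _ => hqA k).1
    (hA_sum.antisymm (hsum.trans hdiv_sum)) h (Finset.mem_univ h)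
  have hqD := (Finset.sum_eq_sum_iff_of_le fun k _ => hdiv k).1
    (hdiv_sum.antisymm (hA_sum.trans hsum)) h (Finset.mem_univ h)
  rw [div_eq_iff (hD h).ne', sq] at hqD
  exact ⟨hA.symm, (mul_left_cancel₀ (hq h).ne' hqD).symm⟩

end WeakLimits

section Limit

variable {N : ℕ} {Ω : Set (Eucl N)} {d m : ℕ} {ι : Type*} {a : Fin (m + 1) → ℕ}
  {V : ι → Fin d → LInf Ω} {B : ι → Fin d → Fin d → LInf Ω} {u : ι → HProd Ω d} {l : Filter ι}
  {V' : Fin d → LInf Ω} {B' : Fin d → Fin d → LInf Ω} {T : H01 Ω →L[ℝ] Lp ℝ 4 (vol Ω)}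
  {v w : HProd Ω d} {e : Fin d → ℝ} {c R γ M : ℝ}

lemma exists_norm_le_of_estimates (a : Fin (m + 1) → ℕ) (hN : 1 ≤ N) (hN3 : N ≤ 3)
    (hΩb : Bornology.IsBounded Ω) (R : ℝ) :
    ∃ R', ∀ (B : Fin d → Fin d → LInf Ω) (γ M : ℝ) (u : HProd Ω d),
      Estimates a B R γ M u → ∀ i, ‖u i‖ ≤ R' := by
  obtain ⟨P, hP, hpoincare⟩ := exists_poincare hN hN3 hΩb
  refine ⟨√((P + 1) * R), fun B γ M u hu i => Real.le_sqrt_of_sq_le ?_⟩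
  have hgrad : ‖gradL2 Ω (u i)‖ ^ 2 ≤ R := by
    rw [norm_sq_gradL2]
    exact (Finset.single_le_sum (fun j _ => integral_nonneg fun x => sq_nonneg ‖grad (u j) x‖)
      (Finset.mem_univ i)).trans hu.1
  calc ‖u i‖ ^ 2
      = ‖toL2 Ω (u i)‖ ^ 2 + ‖gradL2 Ω (u i)‖ ^ 2 := norm_sq_eq_add _
    _ ≤ P * ‖gradL2 Ω (u i)‖ ^ 2 + ‖gradL2 Ω (u i)‖ ^ 2 := by gcongr; exact hpoincare _
    _ = (P + 1) * ‖gradL2 Ω (u i)‖ ^ 2 := by ring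
    _ ≤ (P + 1) * R := by gcongr

lemma IsL4Embedding.exists_ne_zero_of_estimates (hT : IsL4Embedding T) [l.NeBot]
    (hL4 : ∀ i, Tendsto (fun n => T (u n i)) l (𝓝 (T (v i)))) (hγ : 0 < γ)
    (hEst : ∀ᶠ n in l, Estimates a (B n) R γ M (u n)) (h : Fin m) :
    ∃ i ∈ group d a h, T (v i) ≠ 0 := by
  have hle : γ ≤ ∑ i ∈ group d a h, ‖T (v i)‖ ^ 2 := by
    refine ge_of_tendsto (tendsto_finsetSum _ fun i _ => (hL4 i).norm.pow 2) ?_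
    filter_upwards [hEst] with n hn
    simpa only [hT.norm_eq] using hn.2.1 h
  by_contra! hzero
  rw [Finset.sum_eq_zero fun i hi => by rw [hzero i hi, norm_zero, zero_pow two_ne_zero]] at hle
  exact hle.not_gt hγ

namespace CompetingMinimizers

variable (H : CompetingMinimizers a V B u l V' B')
include H

lemma isSegregated_of_tendsto (hT : IsL4Embedding T) [l.NeBot]
    (hL4 : ∀ i, Tendsto (fun n => T (u n i)) l (𝓝 (T (v i))))
    (hM : ∀ᶠ n in l, interGroup a (B n) (u n) ≤ M) : IsSegregated a v := by
  intro i j hij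
  have hmul_le (C : ℝ) : C * overlap (v i) (v j) ≤ M := by
    refine le_of_tendsto ((hT.tendsto_overlap (hL4 i) (hL4 j)).const_mul C) ?_
    filter_upwards [hM, H.eventually_le i j hij (-C)] with n hMn hBn
    calc C * overlap (u n i) (u n j)
        = -(-C * overlap (u n i) (u n j)) := by ring
      _ ≤ -coupling (B n i j) (u n i) (u n j) := neg_le_neg (hT.coupling_le_mul_overlap hBn _ _)
      _ = negCoupling (B n i j) (u n i) (u n j) :=
          (negCoupling_eq_neg_coupling (H.competitive n i j hij) _ _).symm
      _ ≤ M := (negCoupling_le_interGroup _ _ hij).trans hMn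
  by_contra hne
  have := hmul_le ((M + 1) / overlap (v i) (v j))
  rw [div_mul_cancel₀ _ hne] at this
  linarith

variable (ha : IsDecomposition m d a) (hT : IsL4Embedding T)
  (hL2 : ∀ i, Tendsto (fun n => toL2 Ω (u n i)) l (𝓝 (toL2 Ω (v i))))
  (hL4 : ∀ i, Tendsto (fun n => T (u n i)) l (𝓝 (T (v i))))
  (hnorm : ∀ i, Tendsto (fun n => ‖u n i‖ ^ 2) l (𝓝 (‖v i‖ ^ 2 + e i)))
include ha hT hL2 hnorm

lemma sum_groupNormSq_add_le [l.NeBot] (hB' : ∀ i j, B' i j = B' j i) (hV' : IsCoercive c V')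
    (hc : 0 < c) (hw : w ∈ limitSet a V' B') :
    ∑ h, (groupNormSq a V' v h + ∑ i ∈ group d a h, e i) ≤ ∑ h, groupNormSq a V' w h :=
  le_of_forall_gt_imp_ge_of_dense fun _ hE => le_of_tendsto
    (tendsto_finsetSum _ fun h _ => tendsto_groupNormSq H.tendsto_potential hL2 hnorm h)
    ((H.eventually_sum_groupNormSq_lt ha hT hB' hV' hc hw hE).mono fun _ hn => hn.le)

include hL4

lemma groupNormSq_add_le_groupCoupling [l.NeBot] (h : Fin m) :
    groupNormSq a V' v h + ∑ i ∈ group d a h, e i ≤ groupCoupling a B' v h :=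
  le_of_tendsto_of_tendsto' (tendsto_groupNormSq H.tendsto_potential hL2 hnorm h)
    (H.tendsto_groupCoupling hT hL4 h) fun n =>
      (H.competitive n).groupNormSq_le_groupCoupling ha (H.admissible n).1 (H.mem_nehari n) h

lemma tendsto_interGroup : Tendsto (fun n => interGroup a (B n) (u n)) l
    (𝓝 (∑ h, groupCoupling a B' v h -
      ∑ h, (groupNormSq a V' v h + ∑ i ∈ group d a h, e i))) :=
  ((tendsto_finsetSum _ fun h _ => H.tendsto_groupCoupling hT hL4 h).sub
    (tendsto_finsetSum _ fun h _ => tendsto_groupNormSq H.tendsto_potential hL2 hnorm h)).congr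
      fun n => ((H.competitive n).interGroup_eq_sub ha (H.admissible n).1 (H.mem_nehari n)).symm

lemma mem_limitSet_and_defect_eq_zero [l.NeBot] (hadm' : Admissible a V' B')
    (hV' : IsCoercive c V') (hc : 0 < c) (hseg : IsSegregated a v)
    (hne : ∀ h, ∃ i ∈ group d a h, T (v i) ≠ 0) (he : ∀ i, 0 ≤ e i) :
    v ∈ limitSet a V' B' ∧ ∀ i, e i = 0 := by
  have hq (h) : 0 < groupNormSq a V' v h := by
    obtain ⟨i, hi, hTi⟩ := hne h
    exact hV'.groupNormSq_pos hc hi fun hvi => hTi (by rw [hvi, map_zero])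
  have hD (h) : 0 < groupCoupling a B' v h := by
    obtain ⟨i, hi, hTi⟩ := hne h
    exact hadm'.groupCoupling_pos hT hi hTi
  obtain ⟨w, hw, hwsum⟩ := ha.exists_mem_limitSet hadm'.1 hseg hq hD
  have heq := eq_of_sum_le_sum_sq_div hq
    (fun h => le_add_of_nonneg_right (Finset.sum_nonneg fun i _ => he i))
    (H.groupNormSq_add_le_groupCoupling ha hT hL2 hL4 hnorm)
    (hwsum ▸ H.sum_groupNormSq_add_le ha hT hL2 hnorm hadm'.1 hV' hc hw)
  refine ⟨(ha.mem_limitSet_iff hadm'.1).2 ⟨fun h => ⟨(hq h).ne', (heq h).2.symm⟩, hseg⟩,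
    fun i => ?_⟩
  exact (Finset.sum_eq_zero_iff_of_nonneg fun i _ => he i).1
    (add_eq_left.1 (heq (ha.index i)).1) i (ha.mem_group_iff.2 rfl)

end CompetingMinimizers

theorem CompetingMinimizers.exists_tendsto {l : Ultrafilter ι}
    (H : CompetingMinimizers a V B u l V' B') (hN : 1 ≤ N) (hN3 : N ≤ 3)
    (hΩb : Bornology.IsBounded Ω) (ha : IsDecomposition m d a) (hadm' : Admissible a V' B')
    (hγ : 0 < γ) (hEst : ∀ᶠ n in l, Estimates a (B n) R γ M (u n)) :
    ∃ v, Tendsto u l (𝓝 v) ∧ v ∈ limitSet a V' B' ∧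
      IsMinOn (limitEnergy a V' B') (limitSet a V' B') v ∧
      Tendsto (fun n => interGroup a (B n) (u n)) l (𝓝 0) := by
  obtain ⟨T, hT⟩ := exists_isL4Embedding hN hN3 hΩb
  obtain ⟨c, hc, hV'⟩ := hadm'.exists_isCoercive hN hN3 hΩb
  obtain ⟨R', hR'⟩ := exists_norm_le_of_estimates (d := d) a hN hN3 hΩb R
  have hR (i) : ∀ᶠ n in l, ‖u n i‖ ≤ R' := hEst.mono fun n hn => hR' _ _ _ _ hn i
  choose v e hve using fun i => exists_weaklyTendstoWithDefect l (hR i)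
  have hL2 (i) := (hve i).weaklyTendsto.tendsto_toL2 hΩb (hR i)
  have hL4 (i) := hT.tendsto_of_weaklyTendsto hN hN3 hΩb (hve i).weaklyTendsto (hR i)
  have hnorm (i) := (hve i).tendsto_norm_sq
  obtain ⟨hv, he⟩ := H.mem_limitSet_and_defect_eq_zero (v := .toLp 2 v) ha hT hL2 hL4 hnorm hadm'
    hV' hc (H.isSegregated_of_tendsto hT hL4 <| hEst.mono fun n hn =>
      (H.admissible n).sum_negCoupling ha (u n) ▸ hn.2.2)
    (hT.exists_ne_zero_of_estimates hL4 hγ hEst) fun i => (hve i).nonneg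
  obtain rfl : e = 0 := funext he
  refine ⟨.toLp 2 v, ?_, hv, isMinOn_iff.2 fun w hw => ?_, ?_⟩
  · exact ((PiLp.continuous_toLp 2 _).tendsto v).comp (tendsto_pi_nhds.2 fun i => (hve i).tendsto)
  · rw [ha.limitEnergy_eq_of_mem_limitSet hadm'.1 hv, ha.limitEnergy_eq_of_mem_limitSet hadm'.1 hw]
    gcongr ?_ * ?_
    simpa using H.sum_groupNormSq_add_le (v := .toLp 2 v) ha hT hL2 hnorm hadm'.1 hV' hc hw
  · convert H.tendsto_interGroup (v := .toLp 2 v) ha hT hL2 hL4 hnorm using 2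
    refine (sub_eq_zero_of_eq <| Finset.sum_congr rfl fun h _ => ?_).symm
    rw [← (((ha.mem_limitSet_iff hadm'.1).1 hv).1 h).2]
    simp

lemma Estimates.of_tendsto [l.NeBot]
    (hEst : ∀ᶠ n in l, Estimates a (B n) R γ M (u n)) (hu : Tendsto u l (𝓝 v))
    (hT : IsL4Embedding T) (hM : 0 ≤ M) (ha : IsDecomposition m d a) (hseg : IsSegregated a v)
    {V₀ : Fin d → LInf Ω} {B₀ : Fin d → Fin d → LInf Ω} (hadm : Admissible a V₀ B₀) :
    Estimates a B₀ R γ M v := by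
  have hui (i) : Tendsto (fun n => u n i) l (𝓝 (v i)) :=
    ((PiLp.continuous_apply 2 (fun _ : Fin d => H01 Ω) i).tendsto v).comp hu
  refine ⟨?_, fun h => ?_, ?_⟩
  · simp_rw [← norm_sq_gradL2]
    refine le_of_tendsto (tendsto_finsetSum _ fun i _ =>
      (((gradL2 Ω).continuous.tendsto _).comp (hui i)).norm.pow 2) ?_
    filter_upwards [hEst] with n hn
    simpa only [Function.comp_apply, norm_sq_gradL2] using hn.1
  · simp_rw [← hT.norm_eq]
    refine ge_of_tendsto (tendsto_finsetSum _ fun i _ =>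
      ((T.continuous.tendsto _).comp (hui i)).norm.pow 2) ?_
    filter_upwards [hEst] with n hn
    simpa only [Function.comp_apply, hT.norm_eq] using hn.2.1 h
  · classical
    rw [hadm.sum_negCoupling ha, interGroup, Finset.sum_eq_zero]
    · exact hM
    · exact fun p hp => hT.negCoupling_eq_zero _ (hseg _ _ (Finset.mem_filter.1 hp).2)

end Limit

end Segregation

end

open Segregation in
theorem theorem1p9 {N : ℕ} (hN : 1 ≤ N) (hN3 : N ≤ 3)
    (Ω : Set (Eucl N)) (hΩ : IsOpen Ω) (hΩb : Bornology.IsBounded Ω)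
    {d m : ℕ} (a : Fin (m + 1) → ℕ) (ha : IsDecomposition m d a)
    (Vinf : Fin d → LInf Ω) (Binf : Fin d → Fin d → LInf Ω) (hinf : Admissible a Vinf Binf) :
    -- the constants in the estimates depend only on the data fixed so far
    ∃ γU γL M : ℝ, 0 < γU ∧ 0 < γL ∧ 0 < M ∧
      ∀ (V : ℕ → Fin d → LInf Ω) (B : ℕ → Fin d → Fin d → LInf Ω),
        (∀ n, Admissible a (V n) (B n)) →
        (∀ n, ∀ i j, (i, j) ∈ K2 d a → ∀ᵐ x ∂(vol Ω), B n i j x ≤ 0) →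
        (∀ i, Tendsto (fun n => V n i) atTop (𝓝 (Vinf i))) →
        (∀ i, Tendsto (fun n => B n i i) atTop (𝓝 (Binf i i))) →
        (∀ i j, (i, j) ∈ K1 d a → Tendsto (fun n => B n i j) atTop (𝓝 (Binf i j))) →
        -- `β_ij^n → -∞` uniformly, between different groups
        (∀ i j, (i, j) ∈ K2 d a →
          ∀ C : ℝ, ∀ᶠ n in atTop, ∀ᵐ x ∂(vol Ω), B n i j x ≤ C) →
        ∀ u : ℕ → HProd Ω d,
          (∀ n, u n ∈ nehari a (V n) (energy (V n) (B n)) ∧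
            IsMinOn (energy (V n) (B n)) (nehari a (V n) (energy (V n) (B n))) (u n)) →
          (∀ᶠ n in atTop, Estimates a (B n) γU γL M (u n)) ∧
          (∃ uinf : HProd Ω d, ∃ φ : ℕ → ℕ, StrictMono φ ∧
            Tendsto (fun k => u (φ k)) atTop (𝓝 uinf) ∧
            uinf ∈ limitSet a Vinf Binf ∧
            IsMinOn (limitEnergy a Vinf Binf) (limitSet a Vinf Binf) uinf ∧
            ∀ n, Estimates a (B n) γU γL M uinf) ∧
          Tendsto (fun n => interGroup a (B n) (u n)) atTop (𝓝 0) := by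
  obtain ⟨γU, γL, M, hγU, hγL, hM, hest⟩ :=
    exists_uniform_estimates (ι := ℕ) hN hN3 hΩ hΩb ha hinf
  refine ⟨γU, γL, M, hγU, hγL, hM, fun V B hadm hcomp hV hBd hB1 hB2 u hu => ?_⟩
  have hB (h) (i) (hi : i ∈ group d a h) (j) (hj : j ∈ group d a h) :
      Tendsto (fun n => B n i j) atTop (𝓝 (Binf i j)) := by
    rcases eq_or_ne i j with rfl | hij
    exacts [hBd i, hB1 i j ⟨hij, h, hi, hj⟩]
  have H : CompetingMinimizers a V B u atTop Vinf Binf :=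
    ⟨hadm, hcomp, hV, hB, hB2, fun n => (hu n).1, fun n => (hu n).2⟩
  have hEst : ∀ᶠ n in atTop, Estimates a (B n) γU γL M (u n) := hest V B u atTop H
  have hultra (l : Ultrafilter ℕ) (hl : (l : Filter ℕ) ≤ atTop) :=
    (H.mono hl).exists_tendsto hN hN3 hΩb ha hinf hγL (hl hEst)
  refine ⟨hEst, ?_, (tendsto_iff_ultrafilter _ _ _).2 fun l hl => ?_⟩
  · obtain ⟨v, hv, hvmem, hvmin, -⟩ := hultra (Ultrafilter.of atTop) (Ultrafilter.of_le _)
    obtain ⟨φ, hφ, hφv⟩ :=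
      (mapClusterPt_iff_ultrafilter.2 ⟨_, Ultrafilter.of_le _, hv⟩).tendsto_subseq
    obtain ⟨T, hT⟩ := exists_isL4Embedding hN hN3 hΩb
    exact ⟨v, φ, hφ, hφv, hvmem, hvmin, fun n => Estimates.of_tendsto
      (hφ.tendsto_atTop.eventually hEst) hφv hT hM.le ha hvmem.2 (hadm n)⟩
  · obtain ⟨-, -, -, -, hzero⟩ := hultra l hl
    exact hzero
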